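/- **Conventions.** $\{x\}=x-\lfloor x\rfloor$ is the fractional part; complex powers use the principal branch of the logarithm; $\mathbb N_0=\{0,1,2,\dots\}$; for $\Re s>1$ and $x>0$, $\zeta(s,x)=\sum_{k\ge0}(k+x)^{-s}$; and ${}_1F_2(\alpha;\beta,\gamma;z)=\sum_{n\ge0}\frac{(\alpha)_n}{(\beta)_n(\gamma)_n}\frac{z^n}{n!}$. For $a\in\mathbb R\setminus\{0\}$, $b\in\mathbb R$, $d>0$ put $$R_{a,b,d}(s)=s\Big(\int_1^{(1-\{b\})/a}-\int_1^d\Big)\lfloor ax+\{b\}\rfloor\,x^{-s-1}\,dx$$ (if $a<0$, the integrand vanishes between $(1-\{b\})/a$ and $0$, where it is read as $0$), and for $k\ge1$ and $s\in\mathbb C\setminus\mathbb N_0$ put $$\begin{aligned}F_{s,k}(a,b,d)={}&\frac{\sin(2\pi bk)}{d^s s k}\,{}_1F_2\!\left(-\tfrac s2;\tfrac12,1-\tfrac s2;-\pi^2a^2d^2k^2\right)\\&-\frac{2\pi a d^{1-s}\cos(2\pi bk)}{1-s}\,{}_1F_2\!\left(\tfrac{1-s}2;\tfrac32,1+\tfrac{1-s}2;-\pi^2a^2d^2k^2\right)\\&+k^{s-1}(2\pi)^s\Gamma(-s)\frac1{2i}\left((-ia)^se^{2\pi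 i bk}-(ia)^se^{-2\pi i bk}\right).\end{aligned}$$ **Theorem.** Let $a\in\mathbb R\setminus\{0\}$, $b\in\mathbb R$, $d>0$. 1. Each $F_{s,k}(a,b,d)$ extends to an entire function of $s$ (denoted in the same way), the series $\sum_{k\ge1}F_{s,k}(a,b,d)$ converges absolutely for every $s\in\mathbb C$, and its sum is an entire function of $s$. For $\Re s>1$ it satisfies $$\sum_{k=1}^\infty F_{s,k}(a,b,d)=\frac\pi s\begin{cases}a^s\zeta(s,1-\{b\})-\left(\frac{ads}{s-1}+\{b\}-\frac12\right)d^{-s}+R_{a,b,d}(s),&a>0,\\[2pt]-(-a)^s\zeta(s,1-\{-b\})+\left(\frac{ads}{1-s}+\{-b\}-\frac12\right)d^{-s}-R_{-a,-b,d}(s),&a<0,\end{cases}$$ so that the series gives the holomorphic continuation of the right-hand side to $\mathbb C$. 2. For all $C\ge c>0$ and $\epsilon>0$, the series $\sum_{k\ge1}d^sF_{s,k}(a,b,d)$ converges absolutely and uniformly in $b\in\mathbb R$, $c\le|a|\le C$, $c\le d\le C$, $\Re s>-\epsilon$, $|\Im s|<\epsilon$. For every $B\in\mathbb R$, the series $\sum_{k\ge1}F_{s,k}(a,b,d)$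 itself converges absolutely and uniformly on the part of this set where $d\ge1$ or $\Re s\le B$. 3. Let $s\ne0$. If $\Re s<1$ and $b\notin\mathbb Z$, or if $\Re s<0$ and $b\in\mathbb Z$, then (as a limit of partial sums) $$\begin{aligned}\sum_{k=1}^\infty\bigg(&\frac{2\pi a\cos(2\pi bk)}{1-s}\,{}_1F_2\!\left(\tfrac{1-s}2;\tfrac32,1+\tfrac{1-s}2;-\pi^2a^2k^2\right)-\frac{\sin(2\pi bk)}{sk}\,{}_1F_2\!\left(-\tfrac s2;\tfrac12,1-\tfrac s2;-\pi^2a^2k^2\right)\bigg)\\&=\frac\pi s\left(\frac{as}{s-1}+\{b\}-\frac12-R_{a,b,1}(s)\right).\end{aligned}$$ -/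

import Mathlib

noncomputable section

/-- The generalized hypergeometric function `₁F₂(α; β, γ; z)`, as the everywhere convergent series
`∑ (α)ₙ / ((β)ₙ (γ)ₙ) zⁿ / n!` for `β, γ ∉ {0, -1, -2, …}`. -/
def hyp1F2 (α β γ z : ℂ) : ℂ :=
  ∑' n : ℕ, (ascPochhammer ℂ n).eval α /
    ((ascPochhammer ℂ n).eval β * (ascPochhammer ℂ n).eval γ) * (z ^ n / (n.factorial : ℂ))

/-- The hypergeometric part of the `k`-th term (`k ≥ 1`), a meromorphic function of `s` which may
have poles only at `s = 0, 1, 2, …`. -/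
def hyperTerm (a b d : ℝ) (k : ℕ) (s : ℂ) : ℂ :=
  (Real.sin (2 * Real.pi * b * k) : ℂ) / ((d : ℂ) ^ s * s * k) *
      hyp1F2 (-s / 2) (1 / 2) (1 - s / 2)
        (-((Real.pi ^ 2 * a ^ 2 * d ^ 2 * (k : ℝ) ^ 2 : ℝ) : ℂ))
    - 2 * Real.pi * a * (d : ℂ) ^ (1 - s) * (Real.cos (2 * Real.pi * b * k) : ℂ) / (1 - s) *
      hyp1F2 ((1 - s) / 2) (3 / 2) (1 + (1 - s) / 2)
        (-((Real.pi ^ 2 * a ^ 2 * d ^ 2 * (k : ℝ) ^ 2 : ℝ) : ℂ))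

/-- The Gamma part of the `k`-th term (`k ≥ 1`), with principal powers; meromorphic in `s` with
possible poles only at `s = 0, 1, 2, …`. -/
def gammaTerm (a b : ℝ) (k : ℕ) (s : ℂ) : ℂ :=
  (k : ℂ) ^ (s - 1) * (2 * Real.pi : ℂ) ^ s * Complex.Gamma (-s) * (1 / (2 * Complex.I)) *
    ((-Complex.I * a) ^ s * Complex.exp (Complex.I * (2 * Real.pi * b * k))
      - (Complex.I * a) ^ s * Complex.exp (-(Complex.I * (2 * Real.pi * b * k))))

/-- `R_{a,b,d}(s) = s (∫_1^{(1-{b})/a} - ∫_1^d) ⌊a x + {b}⌋ x^{-s-1} dx`. For `a < 0` the integrand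
vanishes on the open interval from `(1-{b})/a` to `0`, so no branch of the power at a negative
base enters. -/
def floorRemainder (a b d : ℝ) (s : ℂ) : ℂ :=
  s * ((∫ x in (1 : ℝ)..((1 - Int.fract b) / a),
          (⌊a * x + Int.fract b⌋ : ℂ) * (x : ℂ) ^ (-s - 1))
      - ∫ x in (1 : ℝ)..d, (⌊a * x + Int.fract b⌋ : ℂ) * (x : ℂ) ^ (-s - 1))

/-- The left-hand side of the principal identity. For `Re s > 1` and `x ∈ (0, 1]`, Mathlib's
`hurwitzZeta x s` is the sum of `(k + x)^{-s}` over `k ≥ 0`. -/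
def zetaSide (a b d : ℝ) (s : ℂ) : ℂ :=
  Real.pi / s *
    (if 0 < a then
      (a : ℂ) ^ s * HurwitzZeta.hurwitzZeta ((1 - Int.fract b : ℝ) : UnitAddCircle) s
        - (a * d * s / (s - 1) + ((Int.fract b : ℝ) : ℂ) - 1 / 2) * (d : ℂ) ^ (-s)
        + floorRemainder a b d s
    else
      -((-a : ℂ) ^ s * HurwitzZeta.hurwitzZeta ((1 - Int.fract (-b) : ℝ) : UnitAddCircle) s)
        + (a * d * s / (1 - s) + ((Int.fract (-b) : ℝ) : ℂ) - 1 / 2) * (d : ℂ) ^ (-s)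
        - floorRemainder (-a) (-b) d s)

/-- The series `∑ f k` converges absolutely and uniformly on `S`: the series of absolute values
and the series itself converge, both of them uniformly on `S`. -/
def AbsUnifConvOn {X : Type*} (f : ℕ → X → ℂ) (S : Set X) : Prop :=
  (∀ x ∈ S, Summable fun k => ‖f k x‖) ∧
  TendstoUniformlyOn (fun N x => ∑ k ∈ Finset.range N, ‖f k x‖) (fun x => ∑' k, ‖f k x‖)
    Filter.atTop S ∧
  TendstoUniformlyOn (fun N x => ∑ k ∈ Finset.range N, f k x) (fun x => ∑' k, f k x)
    Filter.atTop S

/-- Parameters `(a, b, d, s)` with `|a|` and `d` in `[c, C]`, `b` arbitrary, and `s` in the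
half-strip `Re s > -ε`, `|Im s| < ε`. -/
def paramRegion (c C ε : ℝ) : Set (ℝ × ℝ × ℝ × ℂ) :=
  {p | (c ≤ |p.1| ∧ |p.1| ≤ C) ∧ (c ≤ p.2.2.1 ∧ p.2.2.1 ≤ C) ∧
    -ε < p.2.2.2.re ∧ |p.2.2.2.im| < ε}

end

section

open Real Set Filter Topology MeasureTheory

/-! For `Re s > 0` the `k`-th term is `k⁻¹ ∫_d^∞ sin(2πk(ax+b)) x^{-s-1} dx`, so the whole statement
is the Fourier series of the sawtooth, `∑ sin(2πky)/k = π(1/2 - {y})`, integrated against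
`x^{-s-1}`.

Continuation and decay: moving each exponential half of the sine to a vertical ray from `d` turns
oscillation into exponential decay. The ray integral is entire in `s` and `O(d^{-Re s}/k)`; with the
prefactor `1/k` the terms are `O(d^{-Re s}/k²)`, which gives all absolute and uniform convergence
(`exists_norm_fourierTail_le`). No contour is deformed: `hasDerivAt_oscTail` shows that the ray
expression is an antiderivative in `d`, and its limit at infinity fixes the constant.

Closed form: the tail is the integral over `(0, ∞)`, a Gamma value, minus the integral over `(0,
d)`, a lower incomplete Gamma series whose even and odd parts are the two `₁F₂`. This is proved far
to the left in `s` and carried to the right by a recurrence in `s` (`oscTail_eq`, `fourierTail_eq`).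

Sum: the sawtooth partial sums are bounded (`abs_sawSum_le`), so dominated convergence gives `∫_d^∞
saw(ax+b) x^{-s-1} dx`. Almost everywhere `saw(ax+b) = π(1/2 - {b} - ax + ⌊ax+{b}⌋)`, and the Mellin
transform of the floor is a Hurwitz zeta function (`integral_floor_mul_cpow`).

Hypergeometric parts alone: for `d = 1` they are, up to sign, regularised integrals over `(0, 1)`.
The limit is again dominated convergence; near `x = 0` the domination comes from a uniform Lipschitz
bound at `b ∉ ℤ` (`exists_abs_sawSum_sub_le`), or from mere boundedness when `Re s < 0`. -/

/-! ### Partial sums of the sawtooth Fourier series. -/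

/-- The partial sum `∑_{k=1}^N sin(2πky)/k` of the Fourier series of the sawtooth function. -/
noncomputable def sawSum (N : ℕ) (y : ℝ) : ℝ :=
  ∑ k ∈ Finset.range N, sin (2 * π * (k + 1) * y) / (k + 1)

/-- The sawtooth function `π (1/2 - {y})`, with the value `0` at the integers. -/
noncomputable def saw (y : ℝ) : ℝ :=
  if Int.fract y = 0 then 0 else π * (1 / 2 - Int.fract y)

lemma sawSum_add_int (N : ℕ) (y : ℝ) (m : ℤ) : sawSum N (y + m) = sawSum N y := by
  unfold sawSum
  refine Finset.sum_congr rfl fun k _ => ?_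
  have : 2 * π * (k + 1) * (y + m) = 2 * π * (k + 1) * y + ((((k : ℤ) + 1) * m : ℤ) : ℝ) * (2 * π) := by
    push_cast; ring
  rw [this, sin_add_int_mul_two_pi]

lemma sawSum_neg (N : ℕ) (y : ℝ) : sawSum N (-y) = -sawSum N y := by
  simp [sawSum, neg_div]

lemma sawSum_fract (N : ℕ) (y : ℝ) : sawSum N (Int.fract y) = sawSum N y := by
  rw [← sawSum_add_int N (Int.fract y) ⌊y⌋, Int.fract_add_floor]

lemma continuous_sawSum (N : ℕ) : Continuous (sawSum N) := by
  unfold sawSum; fun_prop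

lemma hasDerivAt_sawSum (N : ℕ) (y : ℝ) :
    HasDerivAt (sawSum N) (2 * π * ∑ k ∈ Finset.range N, cos (2 * π * (k + 1) * y)) y := by
  unfold sawSum
  rw [Finset.mul_sum]
  refine HasDerivAt.fun_sum fun k _ => ?_
  have hk : (k : ℝ) + 1 ≠ 0 := by positivity
  have h := (((hasDerivAt_id' y).const_mul (2 * π * (k + 1))).sin).div_const ((k : ℝ) + 1)
  refine h.congr_deriv ?_
  field_simp

/-- Dirichlet kernel: after multiplication by `sin(πy)` the cosines telescope. -/
lemma sin_mul_two_sum_cos (N : ℕ) (y : ℝ) :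
    sin (π * y) * (2 * ∑ k ∈ Finset.range N, cos (2 * π * (k + 1) * y))
      = sin ((2 * N + 1) * π * y) - sin (π * y) := by
  induction N with
  | zero => simp
  | succ n ih =>
    rw [Finset.sum_range_succ, mul_add, mul_add, ih]
    have e1 : (2 * ((n + 1 : ℕ) : ℝ) + 1) * π * y = 2 * π * (n + 1) * y + π * y := by
      push_cast; ring
    have e2 : (2 * (n : ℝ) + 1) * π * y = 2 * π * (n + 1) * y - π * y := by ring
    rw [e1, e2, sin_add, sin_sub]; ring

/-- The summand `-π` is the slope of the limit, so the oscillating quotient alone is the derivative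
of the error. -/
lemma hasDerivAt_sawSum_of_sin_ne_zero (N : ℕ) {y : ℝ} (hy : sin (π * y) ≠ 0) :
    HasDerivAt (sawSum N) (π * (sin ((2 * N + 1) * π * y) / sin (π * y) - 1)) y := by
  convert hasDerivAt_sawSum N y using 1
  have h := sin_mul_two_sum_cos N y
  have : sin ((2 * N + 1) * π * y) / sin (π * y) - 1
      = 2 * ∑ k ∈ Finset.range N, cos (2 * π * (k + 1) * y) := by
    rw [div_sub_one hy, div_eq_iff hy, ← h, mul_comm]
  rw [this]; ring

/-- The error vanishes at `1/2`; integrating its derivative from `y` to `1/2` therefore recovers the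
error at `y`. -/
lemma sawSum_half (N : ℕ) : sawSum N (1 / 2) = 0 := by
  unfold sawSum
  refine Finset.sum_eq_zero fun k _ => ?_
  have : 2 * π * ((k : ℝ) + 1) * (1 / 2) = ((k + 1 : ℕ) : ℝ) * π := by push_cast; ring
  rw [this, sin_nat_mul_pi, zero_div]

lemma two_mul_le_sin_pi_mul {y : ℝ} (h0 : 0 ≤ y) (h1 : y ≤ 1 / 2) : 2 * y ≤ sin (π * y) := by
  have h := mul_le_sin (x := π * y) (by positivity) (by nlinarith [pi_pos])
  have e : 2 / π * (π * y) = 2 * y := by field_simp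
  linarith

/-- The error of the partial sums decays like `1 / (N y)`. -/
lemma abs_sawSum_sub_le (N : ℕ) {y : ℝ} (h0 : 0 < y) (h1 : y ≤ 1 / 2) :
    |sawSum N y - π * (1 / 2 - y)| ≤ 1 / ((2 * N + 1) * y) := by
  set M : ℝ := (2 * N + 1) * π with hM
  have hMpos : 0 < M := by positivity
  have hsin : ∀ u ∈ uIcc y (1 / 2), 0 < sin (π * u) := by
    intro u hu
    rw [uIcc_of_le h1] at hu
    have := two_mul_le_sin_pi_mul (h0.le.trans hu.1) hu.2
    linarith [hu.1]
  have hcos : ∀ u ∈ uIcc y (1 / 2), 0 ≤ cos (π * u) := by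
    intro u hu
    rw [uIcc_of_le h1] at hu
    exact cos_nonneg_of_mem_Icc ⟨by nlinarith [pi_pos, hu.1], by nlinarith [pi_pos, hu.2]⟩
  have hlin : ∀ c u : ℝ, HasDerivAt (fun u : ℝ => c * u) c u := fun c u => by
    simpa using (hasDerivAt_id u).const_mul c
  have hv : ∀ u ∈ uIcc y (1 / 2), HasDerivAt (fun u => (sin (π * u))⁻¹)
      (-(cos (π * u) * π) / sin (π * u) ^ 2) u := fun u hu =>
    ((hlin π u).sin).inv (hsin u hu).ne'
  have hw : ∀ u ∈ uIcc y (1 / 2), HasDerivAt (fun u => -cos (M * u) * (π / M))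
      (sin (M * u) * π) u := fun u _ => by
    have := ((hlin M u).cos.neg).mul_const (π / M)
    have e : sin (M * u) * π = - (-sin (M * u) * M) * (π / M) := by field_simp
    rw [e]
    exact this
  have cS : ContinuousOn (fun u => sin (π * u)) (uIcc y (1 / 2)) := by fun_prop
  have cv : ContinuousOn (fun u => -(cos (π * u) * π) / sin (π * u) ^ 2) (uIcc y (1 / 2)) :=
    ContinuousOn.div (by fun_prop) (by fun_prop) fun u hu => pow_ne_zero _ (hsin u hu).ne'
  have iv := cv.intervalIntegrable (μ := volume)
  have iw : IntervalIntegrable (fun u => sin (M * u) * π) volume y (1 / 2) :=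
    (by fun_prop : Continuous fun u => sin (M * u) * π).intervalIntegrable _ _
  -- Integrating the oscillating factor gains `π / M = 1/(2N+1)`. The other factor `1/sin(πu)`
  -- decreases on `[y, 1/2]`, so its total variation is `1/sin(πy) - 1`.
  have key := intervalIntegral.integral_mul_deriv_eq_deriv_mul hv hw iv iw
  have hS : ∫ u in y..(1 / 2), (sin (π * u))⁻¹ * (sin (M * u) * π)
      = (sawSum N (1 / 2) + π * (1 / 2)) - (sawSum N y + π * y) := by
    refine intervalIntegral.integral_eq_sub_of_hasDerivAt
      (f := fun u => sawSum N u + π * u) (fun u hu => ?_) ?_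
    · have e : (sin (π * u))⁻¹ * (sin (M * u) * π)
          = π * (sin ((2 * N + 1) * π * u) / sin (π * u) - 1) + π := by rw [hM]; ring
      rw [e]
      exact (hasDerivAt_sawSum_of_sin_ne_zero N (hsin u hu).ne').add (hlin π u)
    · refine ContinuousOn.intervalIntegrable (ContinuousOn.mul (cS.inv₀ fun u hu => (hsin u hu).ne') (by fun_prop))
  rw [sawSum_half] at hS
  have hI : |∫ u in y..(1 / 2), (-(cos (π * u) * π) / sin (π * u) ^ 2) * (-cos (M * u) * (π / M))|
      ≤ (π / M) * ((sin (π * y))⁻¹ - 1) := by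
    have hfin : ∫ u in y..(1 / 2), (-(cos (π * u) * π) / sin (π * u) ^ 2)
        = (sin (π * (1 / 2)))⁻¹ - (sin (π * y))⁻¹ :=
      intervalIntegral.integral_eq_sub_of_hasDerivAt hv iv
    have : (π / M) * ((sin (π * y))⁻¹ - 1)
        = ∫ u in y..(1 / 2), (π / M) * -(-(cos (π * u) * π) / sin (π * u) ^ 2) := by
      rw [intervalIntegral.integral_const_mul, intervalIntegral.integral_neg, hfin]
      have : sin (π * (1 / 2)) = 1 := by rw [mul_one_div, sin_pi_div_two]
      rw [this]; ring
    rw [this, ← Real.norm_eq_abs]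
    refine intervalIntegral.norm_integral_le_of_norm_le h1 ?_ (iv.neg.const_mul _)
    refine Eventually.of_forall fun u hu => ?_
    have hu' : u ∈ uIcc y (1 / 2) := by rw [uIcc_of_le h1]; exact Ioc_subset_Icc_self hu
    rw [norm_mul, norm_mul, norm_neg, Real.norm_eq_abs, Real.norm_eq_abs, Real.norm_eq_abs,
      abs_of_pos (div_pos pi_pos hMpos)]
    have ha : |-(cos (π * u) * π) / sin (π * u) ^ 2| = -(-(cos (π * u) * π) / sin (π * u) ^ 2) := by
      rw [abs_of_nonpos]
      rw [neg_div, neg_nonpos]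
      have := hcos u hu'; positivity
    rw [ha]
    have hp : 0 ≤ -(-(cos (π * u) * π) / sin (π * u) ^ 2) := ha ▸ abs_nonneg _
    have := abs_cos_le_one (M * u)
    have hq : 0 ≤ π / M := by positivity
    nlinarith [mul_nonneg hp hq, mul_le_mul_of_nonneg_left this (mul_nonneg hp hq)]
  have e : sawSum N y - π * (1 / 2 - y)
      = -(∫ u in y..(1 / 2), (sin (π * u))⁻¹ * (sin (M * u) * π)) := by rw [hS]; ring
  -- `M/2` is an odd multiple of `π/2`, so the boundary term at `1/2` drops out.
  have hMh : cos (M * (1 / 2)) = 0 := by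
    have : M * (1 / 2) = π / 2 + (N : ℝ) * π := by rw [hM]; ring
    rw [this, cos_add_nat_mul_pi, cos_pi_div_two, mul_zero]
  rw [e, abs_neg, key, hMh]
  have hsy := hsin y left_mem_uIcc
  have hb : |(sin (π * y))⁻¹ * (-cos (M * y) * (π / M))| ≤ (π / M) * (sin (π * y))⁻¹ := by
    rw [abs_mul, abs_mul, abs_neg, abs_of_pos (inv_pos.2 hsy), abs_of_pos (div_pos pi_pos hMpos)]
    have := abs_cos_le_one (M * y)
    have hq : 0 ≤ (sin (π * y))⁻¹ * (π / M) := by positivity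
    nlinarith [mul_le_mul_of_nonneg_left this hq]
  have hfin : π / M * (2 * (sin (π * y))⁻¹) ≤ 1 / ((2 * N + 1) * y) := by
    have h2 := two_mul_le_sin_pi_mul h0.le h1
    have : (sin (π * y))⁻¹ ≤ (2 * y)⁻¹ := inv_anti₀ (by positivity) h2
    have e : π / M = 1 / (2 * N + 1) := by rw [hM]; field_simp
    rw [e]
    calc 1 / (2 * (N : ℝ) + 1) * (2 * (sin (π * y))⁻¹) ≤ 1 / (2 * (N : ℝ) + 1) * (2 * (2 * y)⁻¹) := by
          gcongr
      _ = _ := by field_simp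
  have hq : 0 < π / M := by positivity
  rw [abs_le] at hI hb ⊢
  constructor <;> simp only [neg_zero, zero_mul, mul_zero, zero_sub] <;> nlinarith [hI.1, hI.2, hb.1, hb.2]

lemma abs_sawSum_le_of_small (N : ℕ) (y : ℝ) : |sawSum N y| ≤ 2 * π * N * |y| := by
  unfold sawSum
  refine (Finset.abs_sum_le_sum_abs _ _).trans ?_
  have : ∀ k ∈ Finset.range N, |sin (2 * π * (k + 1) * y) / (k + 1)| ≤ 2 * π * |y| := by
    intro k _
    have hk : (0 : ℝ) < k + 1 := by positivity
    rw [abs_div, abs_of_pos hk, div_le_iff₀ hk]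
    refine abs_sin_le_abs.trans ?_
    rw [abs_mul, abs_of_pos (by positivity)]
    linarith
  refine (Finset.sum_le_card_nsmul _ _ _ this).trans ?_
  simp; linarith

/-- If `Ny ≤ 1`, the termwise bound gives at most `2π`; otherwise the error is at most `1` and the
limit at most `π/2`. The value `8` is a round majorant. -/
lemma abs_sawSum_le_aux (N : ℕ) {y : ℝ} (h0 : 0 ≤ y) (h1 : y ≤ 1 / 2) : |sawSum N y| ≤ 8 := by
  by_cases h : N * y ≤ 1
  · refine (abs_sawSum_le_of_small N y).trans ?_
    rw [abs_of_nonneg h0]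
    nlinarith [pi_lt_d2, pi_pos]
  · push Not at h
    have hy : 0 < y := by
      rcases h0.eq_or_lt with h' | h'
      · rw [← h'] at h; norm_num at h
      · exact h'
    have := abs_sawSum_sub_le N hy h1
    have h2 : 1 / ((2 * N + 1) * y) ≤ 1 := by
      rw [div_le_one (by positivity)]; nlinarith
    rw [abs_le] at this ⊢
    constructor <;> nlinarith [pi_lt_d2, pi_pos, this.1, this.2]

lemma sawSum_one_sub (N : ℕ) (y : ℝ) : sawSum N (1 - y) = -sawSum N y := by
  have := sawSum_add_int N (-y) 1
  rw [sawSum_neg] at this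
  rw [← this]; congr 1; push_cast; ring

/-- The partial sums of the sawtooth series are uniformly bounded. -/
lemma abs_sawSum_le (N : ℕ) (y : ℝ) : |sawSum N y| ≤ 8 := by
  rw [← sawSum_fract]
  have h0 := Int.fract_nonneg y
  have h1 := (Int.fract_lt_one y).le
  by_cases h : Int.fract y ≤ 1 / 2
  · exact abs_sawSum_le_aux N h0 h
  · have := abs_sawSum_le_aux N (y := 1 - Int.fract y) (by linarith) (by linarith)
    rwa [sawSum_one_sub, abs_neg] at this

lemma tendsto_sawSum_aux {y : ℝ} (h0 : 0 < y) (h1 : y ≤ 1 / 2) :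
    Tendsto (fun N => sawSum N y) atTop (𝓝 (π * (1 / 2 - y))) := by
  rw [tendsto_iff_norm_sub_tendsto_zero]
  refine squeeze_zero (fun _ => norm_nonneg _) (fun N => abs_sawSum_sub_le N h0 h1) ?_
  have : Tendsto (fun N : ℕ => (2 * (N : ℝ) + 1) * y) atTop atTop :=
    ((tendsto_atTop_add_const_right _ _ (tendsto_natCast_atTop_atTop.const_mul_atTop two_pos))).atTop_mul_const h0
  simpa only [one_div] using! this.inv_tendsto_atTop

/-- The Fourier series of the sawtooth function converges pointwise. -/
lemma tendsto_sawSum (y : ℝ) : Tendsto (fun N => sawSum N y) atTop (𝓝 (saw y)) := by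
  simp_rw [← sawSum_fract _ y]
  unfold saw
  split_ifs with h
  · rw [h]
    simp [sawSum]
  · have h0 := (Int.fract_nonneg y).lt_of_ne' h
    by_cases h' : Int.fract y ≤ 1 / 2
    · exact tendsto_sawSum_aux h0 h'
    · have h2 := tendsto_sawSum_aux (y := 1 - Int.fract y)
        (by linarith [Int.fract_lt_one y]) (by linarith)
      simp_rw [sawSum_one_sub] at h2
      convert h2.neg using 2 <;> ring

/-- Away from the integers the partial sums are uniformly Lipschitz at a point. -/
lemma exists_abs_sawSum_sub_le {b : ℝ} (hb : ∀ m : ℤ, b ≠ m) :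
    ∃ C : ℝ, ∀ (N : ℕ) (x : ℝ), |sawSum N (b + x) - sawSum N b| ≤ C * |x| := by
  have hsb : sin (π * b) ≠ 0 := by
    intro h
    obtain ⟨m, hm⟩ := sin_eq_zero_iff.1 h
    exact hb m (mul_left_cancel₀ pi_ne_zero (by linarith))
  set m := |sin (π * b)| / 2 with hm
  have hm0 : 0 < m := by positivity
  have hev : ∀ᶠ y in 𝓝 b, m < |sin (π * y)| :=
    (by fun_prop : Continuous fun y => |sin (π * y)|).continuousAt.eventually_const_lt
      (by rw [hm]; linarith [abs_pos.2 hsb])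
  obtain ⟨δ, hδ, hball⟩ := Metric.eventually_nhds_iff_ball.1 hev
  -- Within `δ` of `b` the kernel has denominator above `m`, which bounds the derivative
  -- independently of `N`. Beyond `δ`, the bound `8 + 8` is at most `(16/δ)|x|`.
  refine ⟨max (π * (1 / m + 1)) (16 / δ), fun N x => ?_⟩
  by_cases hx : |x| < δ
  · have := (convex_ball b δ).norm_image_sub_le_of_norm_hasDerivWithin_le (f := sawSum N)
      (f' := fun y => π * (sin ((2 * N + 1) * π * y) / sin (π * y) - 1)) (C := π * (1 / m + 1))
      (x := b) (y := b + x)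
      (fun y hy => (hasDerivAt_sawSum_of_sin_ne_zero N
        (abs_pos.1 (hm0.trans (hball y hy)))).hasDerivWithinAt)
      (fun y hy => ?_) (Metric.mem_ball_self hδ) (by simpa using hx)
    · rw [Real.norm_eq_abs, add_sub_cancel_left, Real.norm_eq_abs] at this
      exact this.trans (by gcongr; exact le_max_left _ _)
    · rw [norm_mul, Real.norm_eq_abs, abs_of_pos pi_pos]
      gcongr
      refine (norm_sub_le _ _).trans ?_
      rw [norm_one, norm_div]
      gcongr
      · exact abs_sin_le_one _
      · exact (hball y hy).le
  · push Not at hx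
    calc |sawSum N (b + x) - sawSum N b| ≤ 8 + 8 :=
          (abs_sub _ _).trans (add_le_add (abs_sawSum_le _ _) (abs_sawSum_le _ _))
      _ ≤ 16 / δ * |x| := by rw [div_mul_eq_mul_div, le_div_iff₀ hδ]; linarith
      _ ≤ _ := by gcongr; exact le_max_right _ _

/-! ### The ray integral: bounds, dependence on the endpoint and on the exponent. -/

/-- `∫_0^∞ e^{-ωt} (d + ηt)^{-s-1} dt`; for `η = ±i` this is, up to a factor, the integral of
`e^{ηωx} x^{-s-1}` along the vertical ray from `d`. -/
noncomputable def rayIntegral (η : ℂ) (ω d : ℝ) (s : ℂ) : ℂ :=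
  ∫ t in Ioi (0 : ℝ), Complex.exp (-(ω * t)) * ((d : ℂ) + η * t) ^ (-s - 1)

/-- The entire continuation of `∫_d^∞ e^{ηωx} x^{-s-1} dx` for `η = ±i`. -/
noncomputable def oscTail (η : ℂ) (ω d : ℝ) (s : ℂ) : ℂ :=
  η * Complex.exp (η * ω * d) * rayIntegral η ω d s

lemma ray_re {η : ℂ} (hη : η = Complex.I ∨ η = -Complex.I) (d t : ℝ) :
    ((d : ℂ) + η * t).re = d := by
  rcases hη with rfl | rfl <;> simp

lemma ray_mem_slitPlane {η : ℂ} (hη : η = Complex.I ∨ η = -Complex.I) {d : ℝ} (hd : 0 < d)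
    (t : ℝ) : (d : ℂ) + η * t ∈ Complex.slitPlane :=
  Or.inl (by rwa [ray_re hη])

lemma norm_eq_one_of_eq_I {η : ℂ} (hη : η = Complex.I ∨ η = -Complex.I) : ‖η‖ = 1 := by
  rcases hη with rfl | rfl <;> simp

lemma le_norm_ray {η : ℂ} (hη : η = Complex.I ∨ η = -Complex.I) {d : ℝ} (t : ℝ) :
    d ≤ ‖(d : ℂ) + η * t‖ := by
  have := Complex.re_le_norm ((d : ℂ) + η * t)
  rwa [ray_re hη] at this

lemma norm_ray_le {η : ℂ} (hη : η = Complex.I ∨ η = -Complex.I) {d t : ℝ} (hd : 0 ≤ d)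
    (ht : 0 ≤ t) : ‖(d : ℂ) + η * t‖ ≤ d + t := by
  refine (norm_add_le _ _).trans ?_
  rw [norm_mul, norm_eq_one_of_eq_I hη]
  simp [abs_of_nonneg hd, abs_of_nonneg ht]

lemma norm_cpow_le_exp_mul (z w : ℂ) : ‖z ^ w‖ ≤ exp (π * |w.im|) * ‖z‖ ^ w.re := by
  refine (Complex.norm_cpow_le z w).trans ?_
  rw [div_eq_mul_inv, ← exp_neg, mul_comm]
  gcongr
  calc -(Complex.arg z * w.im) ≤ |Complex.arg z * w.im| := neg_le_abs _
    _ ≤ π * |w.im| := by rw [abs_mul]; gcongr; exact Complex.abs_arg_le_pi z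

lemma one_add_div_rpow_le_exp {c ε l : ℝ} (hc : 0 < c) (hl : 0 < l) :
    ∃ M : ℝ, 0 < M ∧ ∀ t : ℝ, 0 ≤ t → (1 + t / c) ^ ε ≤ M * exp (l * t) := by
  obtain ⟨n, hn⟩ := exists_nat_ge ε
  -- The constant comes from `yⁿ/n! ≤ e^y` at `y = lc(1 + t/c)`.
  refine ⟨n.factorial / (l * c) ^ n * exp (l * c), by positivity, fun t ht => ?_⟩
  have h1 : 1 ≤ 1 + t / c := by have := div_nonneg ht hc.le; linarith
  have h2 := Real.pow_div_factorial_le_exp (l * c * (1 + t / c)) (by positivity) n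
  have h3 : (1 + t / c) ^ ε ≤ (1 + t / c) ^ n := by
    rw [← rpow_natCast]; exact rpow_le_rpow_of_exponent_le h1 hn
  refine h3.trans ?_
  rw [mul_assoc, ← exp_add]
  have e : l * c + l * t = l * c * (1 + t / c) := by field_simp
  rw [e, div_mul_eq_mul_div, le_div_iff₀ (by positivity), mul_comm ((1 + t / c) ^ n), ← mul_pow]
  rwa [div_le_iff₀ (by positivity), mul_comm (exp _)] at h2

/-- Uniform growth bound for the integrand of the ray integral. -/
lemma exists_norm_ray_cpow_le {c ε l : ℝ} (hc : 0 < c) (hl : 0 < l) :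
    ∃ M : ℝ, 0 < M ∧ ∀ (η : ℂ), (η = Complex.I ∨ η = -Complex.I) → ∀ d : ℝ, c ≤ d → ∀ s : ℂ,
      -ε ≤ s.re → |s.im| ≤ ε → ∀ t : ℝ, 0 ≤ t →
        ‖((d : ℂ) + η * t) ^ (-s - 1)‖ ≤ M * d ^ (-s.re) * exp (l * t) := by
  obtain ⟨M, hM, hexp⟩ := one_add_div_rpow_le_exp (ε := ε) hc hl
  refine ⟨exp (π * ε) * (c⁻¹ * M), by positivity, fun η hη d hd s hs1 hs2 t ht => ?_⟩
  have hd0 : 0 < d := hc.trans_le hd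
  have hε : 0 ≤ ε := (abs_nonneg _).trans hs2
  -- Factoring out `d` isolates the exact power `d^{-Re s}`. As `1 ≤ q ≤ 1 + t/c`, the exponent may
  -- be raised to `ε`; the leftover `d⁻¹` is at most `c⁻¹`.
  set q := ‖(d : ℂ) + η * t‖ / d with hq
  have hq1 : 1 ≤ q := (one_le_div hd0).2 (le_norm_ray hη t)
  have hq2 : q ≤ 1 + t / c := by
    rw [hq, div_le_iff₀ hd0]
    refine (norm_ray_le hη hd0.le ht).trans ?_
    have : t / c * c ≤ t / c * d := by gcongr
    rw [div_mul_cancel₀ _ hc.ne'] at this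
    linarith
  have hz : ‖(d : ℂ) + η * t‖ = d * q := by rw [hq]; field_simp
  have h0 := norm_cpow_le_exp_mul ((d : ℂ) + η * t) (-s - 1)
  have him : (-s - 1).im = -s.im := by simp
  have hre : (-s - 1).re = -s.re - 1 := by simp
  rw [him, abs_neg, hre, hz, mul_rpow hd0.le (by linarith)] at h0
  refine h0.trans ?_
  have h1 : q ^ (-s.re - 1) ≤ M * exp (l * t) := calc
    q ^ (-s.re - 1) ≤ q ^ ε := rpow_le_rpow_of_exponent_le hq1 (by linarith)
    _ ≤ (1 + t / c) ^ ε := by gcongr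
    _ ≤ _ := hexp t ht
  have h2 : d ^ (-s.re - 1) ≤ c⁻¹ * d ^ (-s.re) := by
    rw [rpow_sub_one hd0.ne', div_eq_inv_mul]; gcongr
  calc exp (π * |s.im|) * (d ^ (-s.re - 1) * q ^ (-s.re - 1))
      ≤ exp (π * ε) * ((c⁻¹ * d ^ (-s.re)) * (M * exp (l * t))) := by gcongr
    _ = _ := by ring

lemma continuous_ray_cpow {η : ℂ} (hη : η = Complex.I ∨ η = -Complex.I) {d : ℝ} (hd : 0 < d)
    (w : ℂ) : Continuous fun t : ℝ => ((d : ℂ) + η * t) ^ w :=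
  continuous_iff_continuousAt.2 fun t =>
    ContinuousAt.cpow (by fun_prop) continuousAt_const (ray_mem_slitPlane hη hd t)

lemma continuous_ray_integrand {η : ℂ} (hη : η = Complex.I ∨ η = -Complex.I) (ω : ℝ) {d : ℝ}
    (hd : 0 < d) (w : ℂ) :
    Continuous fun t : ℝ => Complex.exp (-(ω * t)) * ((d : ℂ) + η * t) ^ w :=
  (by fun_prop : Continuous fun t : ℝ => Complex.exp (-((ω : ℂ) * t))).mul
    (continuous_ray_cpow hη hd w)

lemma norm_exp_neg_mul (ω t : ℝ) : ‖Complex.exp (-((ω : ℂ) * t))‖ = exp (-(ω * t)) := by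
  rw [Complex.norm_exp]; simp

/-- Bound for the integrand of the ray integral, with half of the exponential decay left. -/
lemma norm_ray_integrand_le {η : ℂ} {ω d t M : ℝ} {s : ℂ}
    (h : ‖((d : ℂ) + η * t) ^ (-s - 1)‖ ≤ M * d ^ (-s.re) * exp (ω / 2 * t)) :
    ‖Complex.exp (-(ω * t)) * ((d : ℂ) + η * t) ^ (-s - 1)‖
      ≤ M * d ^ (-s.re) * exp (-(ω / 2) * t) := by
  rw [norm_mul, norm_exp_neg_mul]
  calc exp (-(ω * t)) * ‖((d : ℂ) + η * t) ^ (-s - 1)‖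
      ≤ exp (-(ω * t)) * (M * d ^ (-s.re) * exp (ω / 2 * t)) := by gcongr
    _ = M * d ^ (-s.re) * (exp (-(ω * t)) * exp (ω / 2 * t)) := by ring
    _ = _ := by rw [← exp_add]; congr 2; ring

lemma integrableOn_ray_integrand {η : ℂ} (hη : η = Complex.I ∨ η = -Complex.I) {ω d : ℝ}
    (hω : 0 < ω) (hd : 0 < d) (s : ℂ) :
    IntegrableOn (fun t : ℝ => Complex.exp (-(ω * t)) * ((d : ℂ) + η * t) ^ (-s - 1))
      (Ioi 0) := by
  obtain ⟨M, hM, h⟩ := exists_norm_ray_cpow_le (ε := max |s.re| |s.im|) hd (half_pos hω)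
  refine Integrable.mono' ((exp_neg_integrableOn_Ioi 0 (half_pos hω)).const_mul (M * d ^ (-s.re)))
    (continuous_ray_integrand hη ω hd _).aestronglyMeasurable ?_
  refine (ae_restrict_iff' measurableSet_Ioi).2 (Eventually.of_forall fun t ht => ?_)
  exact norm_ray_integrand_le (h η hη d le_rfl s
    (by linarith [neg_abs_le s.re, le_max_left |s.re| |s.im|]) (le_max_right _ _) t (le_of_lt ht))

/-- Uniform bound for the ray integral. -/
lemma exists_norm_rayIntegral_le {c ε ω₀ : ℝ} (hc : 0 < c) (hω₀ : 0 < ω₀) :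
    ∃ M : ℝ, 0 < M ∧ ∀ (η : ℂ), (η = Complex.I ∨ η = -Complex.I) → ∀ d : ℝ, c ≤ d → ∀ s : ℂ,
      -ε ≤ s.re → |s.im| ≤ ε → ∀ ω : ℝ, ω₀ ≤ ω →
        ‖rayIntegral η ω d s‖ ≤ M * d ^ (-s.re) / ω := by
  -- The growth rate is tied to `ω₀`, so `M` does not depend on `ω`; the factor `1/ω` comes from
  -- integrating `e^{-ωt/2}`.
  obtain ⟨M, hM, h⟩ := exists_norm_ray_cpow_le (ε := ε) hc (half_pos hω₀)
  refine ⟨2 * M, by positivity, fun η hη d hd s hs1 hs2 ω hω => ?_⟩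
  have hω0 : 0 < ω := hω₀.trans_le hω
  have hb : ∀ t : ℝ, t ∈ Ioi (0 : ℝ) → ‖Complex.exp (-(ω * t)) * ((d : ℂ) + η * t) ^ (-s - 1)‖
      ≤ M * d ^ (-s.re) * exp (-(ω / 2) * t) := fun t ht =>
    norm_ray_integrand_le ((h η hη d hd s hs1 hs2 t (le_of_lt ht)).trans (by
      have : 0 ≤ t := le_of_lt ht
      have : 0 < d := hc.trans_le hd
      gcongr))
  have h1 := norm_integral_le_of_norm_le (μ := volume.restrict (Ioi (0 : ℝ)))
    ((exp_neg_integrableOn_Ioi 0 (half_pos hω0)).const_mul (M * d ^ (-s.re)))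
    ((ae_restrict_iff' measurableSet_Ioi).2 (Eventually.of_forall hb))
  refine h1.trans (le_of_eq ?_)
  rw [integral_const_mul, integral_exp_mul_Ioi (by linarith)]
  simp only [mul_zero, exp_zero]
  field_simp

lemma hasDerivAt_exp_neg_mul (ω t : ℝ) :
    HasDerivAt (fun t : ℝ => Complex.exp (-((ω : ℂ) * t))) (-ω * Complex.exp (-((ω : ℂ) * t))) t := by
  have h : HasDerivAt (fun z : ℂ => Complex.exp (-((ω : ℂ) * z)))
      (-ω * Complex.exp (-((ω : ℂ) * t))) (t : ℂ) := by
    refine (((hasDerivAt_id' (t : ℂ)).const_mul (ω : ℂ)).fun_neg.cexp).congr_deriv ?_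
    ring
  exact h.comp_ofReal

lemma hasDerivAt_ray_cpow {η : ℂ} (hη : η = Complex.I ∨ η = -Complex.I) {d : ℝ} (hd : 0 < d)
    (w : ℂ) (t : ℝ) :
    HasDerivAt (fun t : ℝ => ((d : ℂ) + η * t) ^ w) (w * ((d : ℂ) + η * t) ^ (w - 1) * η) t := by
  have h : HasDerivAt (fun z : ℂ => ((d : ℂ) + η * z) ^ w)
      (w * ((d : ℂ) + η * t) ^ (w - 1) * η) (t : ℂ) :=
    HasDerivAt.cpow_const (((hasDerivAt_mul_const η).const_add (d : ℂ)).congr_of_eventuallyEq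
      (Eventually.of_forall fun z => by simp [mul_comm])) (ray_mem_slitPlane hη hd t)
  exact h.comp_ofReal

/-- Integration by parts in the ray integral. -/
lemma rayIntegral_add_one {η : ℂ} (hη : η = Complex.I ∨ η = -Complex.I) {ω d : ℝ}
    (hω : 0 < ω) (hd : 0 < d) (s : ℂ) :
    (s + 1) * η * rayIntegral η ω d (s + 1) = (d : ℂ) ^ (-s - 1) - ω * rayIntegral η ω d s := by
  have hi1 := integrableOn_ray_integrand hη hω hd s
  have hi2 := integrableOn_ray_integrand hη hω hd (s + 1)
  have hderiv : ∀ t ∈ Ioi (0 : ℝ),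
      HasDerivAt (fun t : ℝ => Complex.exp (-(ω * t)) * ((d : ℂ) + η * t) ^ (-s - 1))
        (-ω * (Complex.exp (-(ω * t)) * ((d : ℂ) + η * t) ^ (-s - 1)) +
          (-(s + 1) * η) * (Complex.exp (-(ω * t)) * ((d : ℂ) + η * t) ^ (-(s + 1) - 1))) t := by
    intro t _
    refine ((hasDerivAt_exp_neg_mul ω t).mul (hasDerivAt_ray_cpow hη hd (-s - 1) t)).congr_deriv ?_
    have : -s - 1 - 1 = -(s + 1) - 1 := by ring
    rw [this]; ring
  have hlim : Tendsto (fun t : ℝ => Complex.exp (-(ω * t)) * ((d : ℂ) + η * t) ^ (-s - 1))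
      atTop (𝓝 0) := by
    obtain ⟨M, hM, h⟩ := exists_norm_ray_cpow_le (ε := max |s.re| |s.im|) hd (half_pos hω)
    have h0 : Tendsto (fun t : ℝ => M * d ^ (-s.re) * exp (-(ω / 2) * t)) atTop (𝓝 0) := by
      have := (Real.tendsto_exp_atBot.comp
        (tendsto_id.const_mul_atTop_of_neg (neg_lt_zero.2 (half_pos hω)))).const_mul (M * d ^ (-s.re))
      simpa using this
    refine squeeze_zero_norm' ?_ h0
    filter_upwards [eventually_ge_atTop 0] with t ht
    exact norm_ray_integrand_le (h η hη d le_rfl s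
      (by linarith [neg_abs_le s.re, le_max_left |s.re| |s.im|]) (le_max_right _ _) t ht)
  have key := integral_Ioi_of_hasDerivAt_of_tendsto
    (continuous_ray_integrand hη ω hd (-s - 1)).continuousWithinAt hderiv
    ((hi1.const_mul _).add (hi2.const_mul _)) hlim
  rw [integral_add (hi1.const_mul _) (hi2.const_mul _), integral_const_mul, integral_const_mul] at key
  simp only [Complex.ofReal_zero, mul_zero, neg_zero, Complex.exp_zero, add_zero, one_mul] at key
  unfold rayIntegral
  linear_combination -key

lemma sq_eq_neg_one_of_eq_I {η : ℂ} (hη : η = Complex.I ∨ η = -Complex.I) : η * η = -1 := by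
  rcases hη with rfl | rfl <;> simp

/-- The recurrence in `s` that later carries the closed form from a left half-plane to all
admissible `s`. -/
lemma oscTail_add_one {η : ℂ} (hη : η = Complex.I ∨ η = -Complex.I) {ω d : ℝ}
    (hω : 0 < ω) (hd : 0 < d) (s : ℂ) :
    (s + 1) * oscTail η ω d (s + 1)
      = η * ω * oscTail η ω d s + Complex.exp (η * ω * d) * (d : ℂ) ^ (-s - 1) := by
  have h := rayIntegral_add_one hη hω hd s
  unfold oscTail
  linear_combination Complex.exp (η * ω * d) * h
    - Complex.exp (η * ω * d) * ω * rayIntegral η ω d s * sq_eq_neg_one_of_eq_I hη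

lemma rpow_le_rpow_add_rpow {l u x : ℝ} (hl : 0 < l) (h1 : l ≤ x) (h2 : x ≤ u) (p : ℝ) :
    x ^ p ≤ l ^ p + u ^ p := by
  have hx : 0 < x := hl.trans_le h1
  have hu : 0 < u := hx.trans_le h2
  rcases le_total 0 p with hp | hp
  · linarith [rpow_le_rpow hx.le h2 hp, rpow_pos_of_pos hl p]
  · linarith [rpow_le_rpow_of_nonpos hl h1 hp, rpow_pos_of_pos hu p]

lemma hasDerivAt_rayIntegral {η : ℂ} (hη : η = Complex.I ∨ η = -Complex.I) {ω d : ℝ}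
    (hω : 0 < ω) (hd : 0 < d) (s : ℂ) :
    HasDerivAt (fun d => rayIntegral η ω d s) (-(s + 1) * rayIntegral η ω d (s + 1)) d := by
  have hd2 := half_pos hd
  obtain ⟨M, hM, h⟩ := exists_norm_ray_cpow_le (ε := max |(s + 1).re| |(s + 1).im|) hd2 (half_pos hω)
  set u := (d / 2) ^ (-(s + 1).re) + (2 * d) ^ (-(s + 1).re) with hu
  have hball : ∀ x ∈ Metric.ball d (d / 2), d / 2 ≤ x ∧ x ≤ 2 * d := by
    intro x hx
    rw [Real.ball_eq_Ioo] at hx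
    constructor <;> linarith [hx.1, hx.2]
  have key := hasDerivAt_integral_of_dominated_loc_of_deriv_le (μ := volume.restrict (Ioi (0 : ℝ)))
    (F := fun (x : ℝ) (t : ℝ) => Complex.exp (-(ω * t)) * ((x : ℂ) + η * t) ^ (-s - 1))
    (F' := fun (x : ℝ) (t : ℝ) =>
      (-(s + 1)) * (Complex.exp (-(ω * t)) * ((x : ℂ) + η * t) ^ (-(s + 1) - 1)))
    (x₀ := d) (s := Metric.ball d (d / 2))
    (bound := fun t => ‖-(s + 1)‖ * (M * u * exp (-(ω / 2) * t)))
    (Metric.ball_mem_nhds d hd2)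
    (by
      filter_upwards [Metric.ball_mem_nhds d hd2] with x hx
      exact (continuous_ray_integrand hη ω (hd2.trans_le (hball x hx).1) _).aestronglyMeasurable)
    (integrableOn_ray_integrand hη hω hd s)
    ((continuous_ray_integrand hη ω hd _).const_mul _).aestronglyMeasurable
    (by
      refine (ae_restrict_iff' measurableSet_Ioi).2 (Eventually.of_forall fun t ht x hx => ?_)
      rw [norm_mul]
      gcongr
      have hx' := hball x hx
      refine (norm_ray_integrand_le (h η hη x hx'.1 (s + 1)
        (by linarith [neg_abs_le (s + 1).re, le_max_left |(s + 1).re| |(s + 1).im|])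
        (le_max_right _ _) t (le_of_lt ht))).trans ?_
      gcongr
      exact rpow_le_rpow_add_rpow hd2 hx'.1 hx'.2 _)
    (((exp_neg_integrableOn_Ioi 0 (half_pos hω)).const_mul _).const_mul _)
    (by
      refine Eventually.of_forall fun t x hx => ?_
      have hx0 := hd2.trans_le (hball x hx).1
      have h1 : HasDerivAt (fun z : ℂ => (z + η * t) ^ (-s - 1))
          ((-s - 1) * ((x : ℂ) + η * t) ^ (-s - 1 - 1) * 1) (x : ℂ) :=
        HasDerivAt.cpow_const ((hasDerivAt_id' _).add_const _) (ray_mem_slitPlane hη hx0 t)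
      refine (h1.comp_ofReal.const_mul (Complex.exp (-(ω * t)))).congr_deriv ?_
      have : -s - 1 - 1 = -(s + 1) - 1 := by ring
      rw [this]; ring)
  refine key.2.congr_deriv ?_
  rw [integral_const_mul]
  rfl

/-- This replaces the rotation of the contour. Differentiating the exponential prefactor and the ray
integral gives two terms in which the ray integrals cancel by `rayIntegral_add_one`. -/
lemma hasDerivAt_oscTail {η : ℂ} (hη : η = Complex.I ∨ η = -Complex.I) {ω d : ℝ}
    (hω : 0 < ω) (hd : 0 < d) (s : ℂ) :
    HasDerivAt (fun d => oscTail η ω d s) (-(Complex.exp (η * ω * d) * (d : ℂ) ^ (-s - 1))) d := by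
  have h1 : HasDerivAt (fun z : ℂ => Complex.exp (η * ω * z)) (Complex.exp (η * ω * d) * (η * ω)) (d : ℂ) := by
    simpa using ((hasDerivAt_id' (d : ℂ)).const_mul (η * ω)).cexp
  have h2 := (h1.comp_ofReal.const_mul η).mul (hasDerivAt_rayIntegral hη hω hd s)
  refine h2.congr_deriv ?_
  have h3 := rayIntegral_add_one hη hω hd s
  linear_combination -Complex.exp (η * ω * d) * h3
    + Complex.exp (η * ω * d) * ω * rayIntegral η ω d s * sq_eq_neg_one_of_eq_I hη

/-- An integral of entire functions that are locally dominated is entire. -/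
lemma differentiable_integral_of_dominated {α : Type*} [MeasurableSpace α] {μ : Measure α}
    {F : ℂ → α → ℂ} {F' : ℂ → α → ℂ} (hmeas : ∀ s, AEStronglyMeasurable (F s) μ)
    (hmeas' : ∀ s, AEStronglyMeasurable (F' s) μ)
    (hderiv_all : ∀ᵐ x ∂μ, ∀ s, HasDerivAt (F · x) (F' s x) s)
    (hdom : ∀ s₀ : ℂ, ∃ g : α → ℝ, Integrable g μ ∧
      ∀ᵐ x ∂μ, ∀ s ∈ Metric.closedBall s₀ 2, ‖F s x‖ ≤ g x) :
    Differentiable ℂ fun s => ∫ x, F s x ∂μ := by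
  intro s₀
  obtain ⟨g, hg, hle⟩ := hdom s₀
  refine (hasDerivAt_integral_of_dominated_loc_of_deriv_le (F' := F') (bound := g)
    (Metric.ball_mem_nhds s₀ one_pos) (Eventually.of_forall hmeas) ?_ (hmeas' s₀) ?_ hg ?_).2.differentiableAt
  · refine hg.mono' (hmeas s₀) ?_
    filter_upwards [hle] with x hx using hx s₀ (Metric.mem_closedBall_self zero_le_two)
  · filter_upwards [hle, hderiv_all] with x hx hd s hs
    rw [← (hd s).deriv]
    -- Cauchy's estimate on unit circles lets `g` dominate the derivative as well; a unit circle
    -- about a point of the unit ball stays within radius `2`.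
    have := Complex.norm_deriv_le_of_forall_mem_sphere_norm_le (c := s) (f := (F · x)) (C := g x) one_pos
      (Differentiable.diffContOnCl fun s => (hd s).differentiableAt) (fun z hz => hx z ?_)
    · simpa using this
    · rw [Metric.mem_closedBall]
      rw [Metric.mem_ball] at hs
      rw [Metric.mem_sphere] at hz
      linarith [dist_triangle z s s₀]
  · filter_upwards [hderiv_all] with x hx s _ using hx s

lemma differentiable_rayIntegral {η : ℂ} (hη : η = Complex.I ∨ η = -Complex.I) {ω d : ℝ}
    (hω : 0 < ω) (hd : 0 < d) : Differentiable ℂ (rayIntegral η ω d) := by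
  have hder : ∀ t : ℝ, ∀ s : ℂ, HasDerivAt
      (fun s => Complex.exp (-(ω * t)) * ((d : ℂ) + η * t) ^ (-s - 1))
      (Complex.exp (-(ω * t)) * (((d : ℂ) + η * t) ^ (-s - 1) * Complex.log ((d : ℂ) + η * t) * (-1))) s := by
    intro t s
    refine HasDerivAt.const_mul _ (HasDerivAt.const_cpow ?_
      (Or.inl (Complex.slitPlane_ne_zero (ray_mem_slitPlane hη hd t))))
    exact (hasDerivAt_id' s).fun_neg.sub_const 1
  refine differentiable_integral_of_dominated
    (F' := fun s t => Complex.exp (-(ω * t)) * (((d : ℂ) + η * t) ^ (-s - 1) * Complex.log ((d : ℂ) + η * t) * (-1)))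
    (fun s => (continuous_ray_integrand hη ω hd _).aestronglyMeasurable)
    (fun s => ?_) (Eventually.of_forall hder)
    (fun s₀ => ?_)
  · have : Continuous fun t : ℝ => Complex.log ((d : ℂ) + η * t) :=
      continuous_iff_continuousAt.2 fun t =>
        ContinuousAt.clog (by fun_prop) (ray_mem_slitPlane hη hd t)
    exact ((by fun_prop : Continuous fun t : ℝ => Complex.exp (-((ω : ℂ) * t))).mul
      (((continuous_ray_cpow hη hd (-s - 1)).mul this).mul continuous_const)).aestronglyMeasurable
  · set R := ‖s₀‖ + 2 with hR
    obtain ⟨M, hM, h⟩ := exists_norm_ray_cpow_le (ε := R) hd (half_pos hω)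
    refine ⟨fun t => M * (d ^ R + d ^ (-R)) * exp (-(ω / 2) * t),
      (exp_neg_integrableOn_Ioi 0 (half_pos hω)).const_mul _, ?_⟩
    refine (ae_restrict_iff' measurableSet_Ioi).2 (Eventually.of_forall fun t ht s hs => ?_)
    have hn : ‖s‖ ≤ R := by
      rw [Metric.mem_closedBall, dist_eq_norm] at hs
      have := norm_add_le s₀ (s - s₀)
      rw [add_sub_cancel] at this
      linarith
    have hre := (Complex.abs_re_le_norm s).trans hn
    have him := (Complex.abs_im_le_norm s).trans hn
    rw [abs_le] at hre
    refine (norm_ray_integrand_le (h η hη d le_rfl s (by linarith) him t (le_of_lt ht))).trans ?_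
    refine mul_le_mul_of_nonneg_right (mul_le_mul_of_nonneg_left ?_ hM.le) (exp_pos _).le
    rcases le_total 1 d with h1 | h1
    · linarith [rpow_le_rpow_of_exponent_le h1 (show -s.re ≤ R by linarith), rpow_pos_of_pos hd (-R)]
    · linarith [rpow_le_rpow_of_exponent_ge hd h1 (show -R ≤ -s.re by linarith), rpow_pos_of_pos hd R]

lemma differentiable_oscTail {η : ℂ} (hη : η = Complex.I ∨ η = -Complex.I) {ω d : ℝ}
    (hω : 0 < ω) (hd : 0 < d) : Differentiable ℂ (oscTail η ω d) :=
  (differentiable_rayIntegral hη hω hd).const_mul _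

lemma norm_exp_mul_of_eq_I {η : ℂ} (hη : η = Complex.I ∨ η = -Complex.I) (ω d : ℝ) :
    ‖Complex.exp (η * ω * d)‖ = 1 := by
  rw [Complex.norm_exp]
  rcases hη with rfl | rfl <;> simp

lemma norm_oscTail {η : ℂ} (hη : η = Complex.I ∨ η = -Complex.I) (ω d : ℝ) (s : ℂ) :
    ‖oscTail η ω d s‖ = ‖rayIntegral η ω d s‖ := by
  rw [oscTail, norm_mul, norm_mul, norm_exp_mul_of_eq_I hη, norm_eq_one_of_eq_I hη, one_mul, one_mul]

lemma norm_ofReal_cpow_of_pos {x : ℝ} (hx : 0 < x) (w : ℂ) : ‖(x : ℂ) ^ w‖ = x ^ w.re :=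
  Complex.norm_cpow_eq_rpow_re_of_pos hx w

lemma integrableOn_osc {η : ℂ} (hη : η = Complex.I ∨ η = -Complex.I) (ω : ℝ) {d : ℝ}
    (hd : 0 < d) {s : ℂ} (hs : 0 < s.re) :
    IntegrableOn (fun x : ℝ => Complex.exp (η * ω * x) * (x : ℂ) ^ (-s - 1)) (Ioi d) := by
  refine Integrable.mono' (integrableOn_Ioi_rpow_of_lt (a := (-s - 1).re) (by simp; linarith) hd) ?_ ?_
  · refine ContinuousOn.aestronglyMeasurable (ContinuousOn.mul (by fun_prop) ?_) measurableSet_Ioi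
    exact fun x hx => (Complex.continuousAt_ofReal_cpow_const x _ (Or.inr (hd.trans hx).ne')).continuousWithinAt
  · refine (ae_restrict_iff' measurableSet_Ioi).2 (Eventually.of_forall fun x hx => ?_)
    rw [norm_mul, norm_exp_mul_of_eq_I hη, norm_ofReal_cpow_of_pos (hd.trans hx), one_mul]

/-- Both sides have the same derivative in `d`, and `oscTail` tends to `0` at infinity like `d^{-Re
s}`. -/
lemma oscTail_eq_integral {η : ℂ} (hη : η = Complex.I ∨ η = -Complex.I) {ω d : ℝ}
    (hω : 0 < ω) (hd : 0 < d) {s : ℂ} (hs : 0 < s.re) :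
    oscTail η ω d s = ∫ x in Ioi d, Complex.exp (η * ω * x) * (x : ℂ) ^ (-s - 1) := by
  have hlim : Tendsto (fun d => oscTail η ω d s) atTop (𝓝 0) := by
    obtain ⟨M, hM, h⟩ := exists_norm_rayIntegral_le (ε := |s.im|) one_pos hω
    have h0 : Tendsto (fun x : ℝ => M * x ^ (-s.re) / ω) atTop (𝓝 0) := by
      simpa using ((tendsto_rpow_neg_atTop hs).const_mul M).div_const ω
    refine squeeze_zero_norm' ?_ h0
    filter_upwards [eventually_ge_atTop 1] with x hx
    rw [norm_oscTail hη]
    exact h η hη x hx s (by linarith [abs_nonneg s.im]) le_rfl ω le_rfl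
  have key := integral_Ioi_of_hasDerivAt_of_tendsto
    (hasDerivAt_oscTail hη hω hd s).continuousAt.continuousWithinAt
    (fun x hx => hasDerivAt_oscTail hη hω (hd.trans hx) s) (integrableOn_osc hη ω hd hs).neg hlim
  rw [integral_neg] at key
  linear_combination key

lemma ofReal_mul_cpow {r : ℝ} (hr : 0 < r) {z : ℂ} (hz : z ≠ 0) (w : ℂ) :
    ((r : ℂ) * z) ^ w = (r : ℂ) ^ w * z ^ w := by
  have hr' : (r : ℂ) ≠ 0 := Complex.ofReal_ne_zero.2 hr.ne'
  rw [Complex.cpow_def_of_ne_zero (mul_ne_zero hr' hz), Complex.cpow_def_of_ne_zero hr',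
    Complex.cpow_def_of_ne_zero hz, Complex.log_ofReal_mul hr hz, Complex.ofReal_log hr.le, add_mul,
    Complex.exp_add]

/-- The value at `d = 0` of the ray integral, a Gamma integral. -/
lemma rayIntegral_zero {η : ℂ} (hη : η = Complex.I ∨ η = -Complex.I) {ω : ℝ}
    (hω : 0 < ω) {s : ℂ} (hs : s.re < 0) :
    η * rayIntegral η ω 0 s = (-η) ^ s * (ω : ℂ) ^ s * Complex.Gamma (-s) := by
  have hη0 : η ≠ 0 := by rcases hη with rfl | rfl <;> simp
  have h1 : rayIntegral η ω 0 s
      = η ^ (-s - 1) * ∫ t in Ioi (0 : ℝ), (t : ℂ) ^ (-s - 1) * Complex.exp (-(ω * t)) := by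
    unfold rayIntegral
    rw [← integral_const_mul]
    refine setIntegral_congr_fun measurableSet_Ioi fun t ht => ?_
    simp only [Complex.ofReal_zero, zero_add]
    have : (η * t) ^ (-s - 1) = η ^ (-s - 1) * (t : ℂ) ^ (-s - 1) := by
      rw [mul_comm η, ofReal_mul_cpow ht hη0, mul_comm]
    rw [this]; ring
  rw [h1, Complex.integral_cpow_mul_exp_neg_mul_Ioi (by simpa using hs) hω]
  have h2 : (1 / (ω : ℂ)) ^ (-s) = (ω : ℂ) ^ s := by
    rw [one_div, Complex.inv_cpow, Complex.cpow_neg, inv_inv]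
    rw [Complex.arg_ofReal_of_nonneg hω.le]; exact pi_pos.ne
  -- For `η = ±i` the inverse is `-η`, and its argument is not `π`, so the principal power inverts
  -- without a branch correction.
  have h3 : (-η) ^ s = η ^ (-s) := by
    have : -η = η⁻¹ := by
      refine eq_inv_of_mul_eq_one_left ?_
      linear_combination -sq_eq_neg_one_of_eq_I hη
    rw [this, Complex.inv_cpow, Complex.cpow_neg]
    rcases hη with rfl | rfl
    · rw [Complex.arg_I]; linarith [pi_pos]
    · rw [Complex.arg_neg_I]; linarith [pi_pos]
  rw [h2, h3, Complex.cpow_sub _ _ hη0, Complex.cpow_one]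
  field_simp

/-- For `Re s < -1` the power `-s-1` has positive real part, so the integrand stays bounded as `d →
0` and is dominated uniformly in `d ≤ 1`. -/
lemma tendsto_oscTail_zero {η : ℂ} (hη : η = Complex.I ∨ η = -Complex.I) {ω : ℝ}
    (hω : 0 < ω) {s : ℂ} (hs : s.re < -1) :
    Tendsto (fun d => oscTail η ω d s) (𝓝[>] 0)
      (𝓝 ((-η) ^ s * (ω : ℂ) ^ s * Complex.Gamma (-s))) := by
  rw [← rayIntegral_zero hη hω (by linarith)]
  have hE : Tendsto (fun d : ℝ => η * Complex.exp (η * ω * d)) (𝓝[>] 0) (𝓝 η) := by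
    have : Continuous fun d : ℝ => η * Complex.exp (η * ω * d) := by fun_prop
    simpa using (this.tendsto 0).mono_left nhdsWithin_le_nhds
  refine hE.mul ?_
  obtain ⟨M, hM, hexp⟩ := one_add_div_rpow_le_exp (c := 1) (ε := -s.re - 1) one_pos (half_pos hω)
  refine tendsto_integral_filter_of_dominated_convergence
    (fun t => exp (π * |s.im|) * (M * exp (-(ω / 2) * t))) ?_ ?_
    (((exp_neg_integrableOn_Ioi 0 (half_pos hω)).const_mul _).const_mul _) ?_
  · filter_upwards [self_mem_nhdsWithin] with d hd
    exact (continuous_ray_integrand hη ω hd _).aestronglyMeasurable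
  · filter_upwards [self_mem_nhdsWithin, mem_nhdsWithin_of_mem_nhds (Iic_mem_nhds (zero_lt_one' ℝ))] with d hd hd1
    refine (ae_restrict_iff' measurableSet_Ioi).2 (Eventually.of_forall fun t ht => ?_)
    have ht0 : 0 ≤ t := le_of_lt ht
    have hd0 : 0 ≤ d := le_of_lt hd
    rw [norm_mul, norm_exp_neg_mul]
    have h0 := norm_cpow_le_exp_mul ((d : ℂ) + η * t) (-s - 1)
    have him : (-s - 1).im = -s.im := by simp
    have hre : (-s - 1).re = -s.re - 1 := by simp
    rw [him, abs_neg, hre] at h0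
    have h1 : ‖(d : ℂ) + η * t‖ ^ (-s.re - 1) ≤ M * exp (ω / 2 * t) := by
      refine le_trans ?_ (hexp t ht0)
      refine rpow_le_rpow (norm_nonneg _) ?_ (by linarith)
      have := norm_ray_le hη hd0 ht0
      rw [mem_Iic] at hd1
      rw [div_one]; linarith
    calc exp (-(ω * t)) * ‖((d : ℂ) + η * t) ^ (-s - 1)‖
        ≤ exp (-(ω * t)) * (exp (π * |s.im|) * (M * exp (ω / 2 * t))) := by
          gcongr; exact h0.trans (by gcongr)
      _ = exp (π * |s.im|) * (M * (exp (-(ω * t)) * exp (ω / 2 * t))) := by ring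
      _ = _ := by rw [← exp_add]; congr 3; ring
  · refine (ae_restrict_iff' measurableSet_Ioi).2 (Eventually.of_forall fun t ht => ?_)
    refine Tendsto.const_mul _ (Tendsto.mono_left ?_ nhdsWithin_le_nhds)
    have ht0 : 0 < t := ht
    have hslit : ((0 : ℝ) : ℂ) + η * t ∈ Complex.slitPlane := by
      refine Or.inr ?_
      rcases hη with rfl | rfl <;> simp [ht0.ne']
    exact ContinuousAt.cpow (f := fun d : ℝ => (d : ℂ) + η * t) (by fun_prop) continuousAt_const hslit

/-- The antiderivative `-oscTail` is evaluated between `0` and `d`, with its boundary value at `0`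
equal to minus the complete Gamma integral. -/
lemma oscTail_add_integral {η : ℂ} (hη : η = Complex.I ∨ η = -Complex.I) {ω d : ℝ}
    (hω : 0 < ω) (hd : 0 < d) {s : ℂ} (hs : s.re < -1) :
    oscTail η ω d s + ∫ x in (0 : ℝ)..d, Complex.exp (η * ω * x) * (x : ℂ) ^ (-s - 1)
      = (-η) ^ s * (ω : ℂ) ^ s * Complex.Gamma (-s) := by
  have hint : IntervalIntegrable (fun x : ℝ => Complex.exp (η * ω * x) * (x : ℂ) ^ (-s - 1)) volume 0 d :=
    (intervalIntegral.intervalIntegrable_cpow' (by simp; linarith)).continuousOn_mul (by fun_prop)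
  have := intervalIntegral.integral_eq_sub_of_hasDerivAt_of_tendsto hd
    (fun x hx => hasDerivAt_oscTail hη hω hx.1 s) hint.neg (tendsto_oscTail_zero hη hω hs)
    ((hasDerivAt_oscTail hη hω hd s).continuousAt.tendsto.mono_left nhdsWithin_le_nhds)
  rw [intervalIntegral.integral_neg] at this
  linear_combination -this

/-! ### The lower incomplete Gamma series and the closed form of the tail. -/

/-- The series `∑ xⁿ / (n! (n - s))`, the power series of the lower incomplete Gamma function. -/
noncomputable def lowerGammaSeries (x s : ℂ) : ℂ :=
  ∑' n : ℕ, x ^ n / (n.factorial * (n - s))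

lemma summable_lowerGammaSeries (x s : ℂ) :
    Summable fun n : ℕ => x ^ n / (n.factorial * (n - s)) := by
  refine Summable.of_norm_bounded_eventually_nat (g := fun n => ‖x‖ ^ n / n.factorial)
    (Real.summable_pow_div_factorial ‖x‖) ?_
  obtain ⟨m, hm⟩ := exists_nat_ge (‖s‖ + 1)
  filter_upwards [eventually_ge_atTop m] with n hn
  have h1 : (1 : ℝ) ≤ ‖(n : ℂ) - s‖ := by
    have h := norm_sub_norm_le (n : ℂ) s
    rw [Complex.norm_natCast] at h
    have : (m : ℝ) ≤ n := by exact_mod_cast hn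
    linarith
  have hf : (0 : ℝ) < n.factorial := by positivity
  rw [norm_div, norm_pow, norm_mul, Complex.norm_natCast]
  gcongr
  exact le_mul_of_one_le_right hf.le h1

/-- From `n/(n-(s+1)) - 1 = (s+1)/(n-(s+1))`: the coefficient `n` lowers the factorial and shifts
the series, and the subtracted `1` produces the exponential. -/
lemma lowerGammaSeries_add_one (x s : ℂ) (hs : ∀ n : ℕ, s + 1 ≠ n) :
    (s + 1) * lowerGammaSeries x (s + 1) = x * lowerGammaSeries x s - Complex.exp x := by
  have h1 := summable_lowerGammaSeries x s
  have h2 : HasSum (fun n : ℕ => x ^ n / (n.factorial : ℂ)) (Complex.exp x) := by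
    rw [Complex.exp_eq_exp_ℂ]; exact NormedSpace.expSeries_div_hasSum_exp x
  have h3 : HasSum (fun n : ℕ => n * (x ^ n / (n.factorial * (n - (s + 1)))))
      (x * lowerGammaSeries x s) := by
    rw [← hasSum_nat_add_iff' 1]
    simp only [Finset.range_one, Finset.sum_singleton, Nat.cast_zero, zero_mul, sub_zero]
    refine (h1.hasSum.mul_left x).congr_fun fun n => ?_
    have hn : (n : ℂ) - s ≠ 0 := fun h => hs (n + 1) (by push_cast; linear_combination -h)
    have hn' : ((n + 1 : ℕ) : ℂ) - (s + 1) = n - s := by push_cast; ring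
    have hf : (n.factorial : ℂ) ≠ 0 := Nat.cast_ne_zero.2 n.factorial_ne_zero
    have hc : ((n + 1 : ℕ) : ℂ) ≠ 0 := Nat.cast_ne_zero.2 n.succ_ne_zero
    rw [hn', Nat.factorial_succ, Nat.cast_mul]
    field_simp
    ring
  have h4 := h3.sub h2
  rw [← h4.tsum_eq, lowerGammaSeries, ← tsum_mul_left]
  refine tsum_congr fun n => ?_
  have hn : (n : ℂ) - (s + 1) ≠ 0 := sub_ne_zero.2 (hs n).symm
  have hf : (n.factorial : ℂ) ≠ 0 := Nat.cast_ne_zero.2 n.factorial_ne_zero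
  field_simp
  ring

lemma summable_shifted_exp (y d : ℝ) (hd : 0 < d) :
    Summable fun n : ℕ => y ^ (n + 1) / (n + 1).factorial * d ^ n := by
  have h := ((summable_nat_add_iff 1).2 (Real.summable_pow_div_factorial (y * d))).mul_right d⁻¹
  refine h.congr fun n => ?_
  rw [mul_pow]
  field_simp
  ring

/-- Removing the constant term of the exponential gains one power of `x` at `0`, which widens the
range of termwise integration from `Re s < 0` to `Re s < 1`. -/
lemma hasSum_integral_exp_sub_one_mul_cpow (z : ℂ) {d : ℝ} (hd : 0 < d) {s : ℂ} (hs : s.re < 1) :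
    HasSum (fun n : ℕ => (d : ℂ) ^ (-s) * ((z * d) ^ (n + 1) / ((n + 1).factorial * ((n + 1 : ℕ) - s))))
      (∫ x in (0 : ℝ)..d, (Complex.exp (z * x) - 1) * (x : ℂ) ^ (-s - 1)) := by
  have hb := summable_shifted_exp ‖z‖ d hd
  have key := intervalIntegral.hasSum_integral_of_dominated_convergence (μ := volume) (a := 0) (b := d)
    (F := fun (n : ℕ) (x : ℝ) => z ^ (n + 1) / ((n + 1).factorial : ℂ) * (x : ℂ) ^ ((n : ℂ) - s))
    (f := fun x : ℝ => (Complex.exp (z * x) - 1) * (x : ℂ) ^ (-s - 1))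
    (fun n x => (‖z‖ ^ (n + 1) / (n + 1).factorial * d ^ n) * x ^ (-s.re)) ?_ ?_ ?_ ?_ ?_
  · refine key.congr_fun fun n => ?_
    have hre : -1 < ((n : ℂ) - s).re := by
      have : (0 : ℝ) ≤ n := n.cast_nonneg
      simp; linarith
    have hne : (n : ℂ) - s + 1 ≠ 0 := fun h => by
      have := congrArg Complex.re h
      simp at this hre
      linarith
    rw [intervalIntegral.integral_const_mul, integral_cpow (Or.inl hre), Complex.ofReal_zero,
      Complex.zero_cpow hne, sub_zero]
    have e1 : (d : ℂ) ^ ((n : ℂ) - s + 1) = (d : ℂ) ^ (-s) * (d : ℂ) ^ (n + 1) := by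
      rw [← Complex.cpow_natCast, ← Complex.cpow_add _ _ (Complex.ofReal_ne_zero.2 hd.ne')]
      congr 1; push_cast; ring
    have e2 : ((n + 1 : ℕ) : ℂ) - s = n - s + 1 := by push_cast; ring
    rw [e1, e2, mul_pow]
    have hf : ((n + 1).factorial : ℂ) ≠ 0 := Nat.cast_ne_zero.2 (n + 1).factorial_ne_zero
    field_simp
  · intro n
    rw [uIoc_of_le hd.le]
    refine ContinuousOn.aestronglyMeasurable (ContinuousOn.mul continuousOn_const ?_) measurableSet_Ioc
    exact fun x hx => (Complex.continuousAt_ofReal_cpow_const x _ (Or.inr hx.1.ne')).continuousWithinAt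
  · refine fun n => Eventually.of_forall fun x hx => ?_
    rw [uIoc_of_le hd.le] at hx
    rw [norm_mul, norm_div, norm_pow, Complex.norm_natCast, norm_ofReal_cpow_of_pos hx.1, mul_assoc]
    gcongr
    have : ((n : ℂ) - s).re = n + -s.re := by simp; ring
    rw [this, rpow_add hx.1, rpow_natCast]
    have := hx.1.le
    gcongr
    exact hx.2
  · exact Eventually.of_forall fun x _ => hb.mul_right _
  · simp_rw [tsum_mul_right]
    exact (intervalIntegral.intervalIntegrable_rpow' (by linarith)).const_mul _
  · refine Eventually.of_forall fun x hx => ?_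
    rw [uIoc_of_le hd.le] at hx
    have hx0 : (x : ℂ) ≠ 0 := Complex.ofReal_ne_zero.2 hx.1.ne'
    have h2 : HasSum (fun n : ℕ => (z * x) ^ n / (n.factorial : ℂ)) (Complex.exp (z * x)) := by
      rw [Complex.exp_eq_exp_ℂ]; exact NormedSpace.expSeries_div_hasSum_exp _
    have h3 := (hasSum_nat_add_iff' 1).2 h2
    simp only [Finset.range_one, Finset.sum_singleton, pow_zero, Nat.factorial_zero, Nat.cast_one,
      div_one] at h3
    refine (h3.mul_right ((x : ℂ) ^ (-s - 1))).congr_fun fun n => ?_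
    have e1 : (x : ℂ) ^ ((n : ℂ) - s) = (x : ℂ) ^ (n + 1) * (x : ℂ) ^ (-s - 1) := by
      rw [← Complex.cpow_natCast, ← Complex.cpow_add _ _ hx0]
      congr 1; push_cast; ring
    rw [e1, mul_pow]; ring

/-- The incomplete integral minus its leading singular term, for `Re s < 1`. -/
lemma integral_exp_sub_one_mul_cpow (z : ℂ) {d : ℝ} (hd : 0 < d) {s : ℂ} (hs : s.re < 1)
    (hs0 : s ≠ 0) :
    ∫ x in (0 : ℝ)..d, (Complex.exp (z * x) - 1) * (x : ℂ) ^ (-s - 1)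
      = (d : ℂ) ^ (-s) * (lowerGammaSeries (z * d) s + 1 / s) := by
  have h1 := hasSum_integral_exp_sub_one_mul_cpow z hd hs
  have h2 := (hasSum_nat_add_iff' 1).2 ((summable_lowerGammaSeries (z * d) s).hasSum.mul_left ((d : ℂ) ^ (-s)))
  rw [h1.unique h2, lowerGammaSeries]
  simp
  field_simp

lemma integral_exp_mul_cpow (z : ℂ) {d : ℝ} (hd : 0 < d) {s : ℂ} (hs : s.re < 0) :
    ∫ x in (0 : ℝ)..d, Complex.exp (z * x) * (x : ℂ) ^ (-s - 1)
      = (d : ℂ) ^ (-s) * lowerGammaSeries (z * d) s := by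
  have hs0 : s ≠ 0 := by rintro rfl; simp at hs
  have hre : -1 < (-s - 1).re := by simp; linarith
  have hi := intervalIntegral.intervalIntegrable_cpow' (a := 0) (b := d) hre
  have hE : IntervalIntegrable (fun x : ℝ => (Complex.exp (z * x) - 1) * (x : ℂ) ^ (-s - 1)) volume 0 d :=
    hi.continuousOn_mul (by fun_prop)
  have h1 := integral_exp_sub_one_mul_cpow z hd (by linarith) hs0
  have h2 := integral_cpow (a := 0) (b := d) (Or.inl hre)
  have e : (fun x : ℝ => Complex.exp (z * x) * (x : ℂ) ^ (-s - 1))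
      = fun x : ℝ => (Complex.exp (z * x) - 1) * (x : ℂ) ^ (-s - 1) + (x : ℂ) ^ (-s - 1) := by
    funext x; ring
  rw [e, intervalIntegral.integral_add hE hi, h1, h2, sub_add_cancel, Complex.ofReal_zero,
    Complex.zero_cpow (neg_ne_zero.2 hs0)]
  field_simp
  ring

lemma cpow_add_one_of_ne_zero {x : ℂ} (s : ℂ) (hx : x ≠ 0) : x ^ (s + 1) = x ^ s * x := by
  rw [Complex.cpow_add _ _ hx, Complex.cpow_one]

/-- The entire continuation of the tail integral in terms of the lower incomplete Gamma series. -/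
lemma oscTail_eq {η : ℂ} (hη : η = Complex.I ∨ η = -Complex.I) {ω d : ℝ}
    (hω : 0 < ω) (hd : 0 < d) (s : ℂ) (hs : ∀ n : ℕ, s ≠ n) :
    oscTail η ω d s = -((d : ℂ) ^ (-s) * lowerGammaSeries (η * ω * d) s)
      + (-η) ^ s * (ω : ℂ) ^ s * Complex.Gamma (-s) := by
  -- Induction moves the half-plane to the right by one. The base case splits the integral over `(0,
  -- ∞)` at `d`; in the step the tail, the series and the Gamma value obey matching recurrences.
  have main : ∀ m : ℕ, ∀ s : ℂ, s.re < m - 1 → (∀ n : ℕ, s ≠ n) →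
      oscTail η ω d s = -((d : ℂ) ^ (-s) * lowerGammaSeries (η * ω * d) s)
        + (-η) ^ s * (ω : ℂ) ^ s * Complex.Gamma (-s) := by
    intro m
    induction m with
    | zero =>
      intro s hs _
      simp only [Nat.cast_zero, zero_sub] at hs
      rw [← oscTail_add_integral hη hω hd hs, integral_exp_mul_cpow _ hd (by linarith)]
      ring
    | succ m ih =>
      intro s hs hn
      obtain ⟨r, rfl⟩ : ∃ r, s = r + 1 := ⟨s - 1, by ring⟩
      have hr0 : r + 1 ≠ 0 := by simpa using hn 0
      have hr := ih r (by simp at hs; linarith) fun n h => hn (n + 1) (by rw [h]; push_cast; ring)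
      have h1 := oscTail_add_one hη hω hd r
      have h2 := lowerGammaSeries_add_one (η * ω * d) r hn
      have hη0 : -η ≠ 0 := by rcases hη with rfl | rfl <;> simp
      have hω0 : (ω : ℂ) ≠ 0 := Complex.ofReal_ne_zero.2 hω.ne'
      have hd0 : (d : ℂ) ≠ 0 := Complex.ofReal_ne_zero.2 hd.ne'
      have h3 : Complex.Gamma (-r) = -(r + 1) * Complex.Gamma (-(r + 1)) := by
        have := Complex.Gamma_add_one (-(r + 1)) (neg_ne_zero.2 hr0)
        rw [← this]; congr 1; ring
      have e1 : (d : ℂ) ^ (-r - 1) = (d : ℂ) ^ (-(r + 1)) := by congr 1; ring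
      have e2 : (d : ℂ) ^ (-r) = (d : ℂ) ^ (-(r + 1)) * d := by
        rw [← cpow_add_one_of_ne_zero _ hd0]; congr 1; ring
      rw [e1, hr, h3, e2] at h1
      rw [cpow_add_one_of_ne_zero _ hη0, cpow_add_one_of_ne_zero _ hω0]
      refine mul_left_cancel₀ hr0 ?_
      linear_combination h1 + (d : ℂ) ^ (-(r + 1)) * h2
  obtain ⟨m, hm⟩ := exists_nat_gt (s.re + 1)
  exact main m s (by linarith) hs

/-! ### The hypergeometric functions as even and odd parts of the Gamma series. -/

/-- This is `(α)ₙ/(α+1)ₙ = α/(α+n)`, the source of the denominators `n - s`. -/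
lemma ascPochhammer_eval_mul_add (α : ℂ) (n : ℕ) :
    (ascPochhammer ℂ n).eval α * (α + n) = α * (ascPochhammer ℂ n).eval (α + 1) := by
  induction n with
  | zero => simp
  | succ n ih =>
    rw [ascPochhammer_succ_eval, ascPochhammer_succ_eval, ih]
    push_cast; ring

lemma ascPochhammer_eval_ne_zero {α : ℂ} (h : ∀ n : ℕ, α + n ≠ 0) (n : ℕ) :
    (ascPochhammer ℂ n).eval α ≠ 0 := by
  induction n with
  | zero => simp
  | succ n ih => rw [ascPochhammer_succ_eval]; exact mul_ne_zero ih (h n)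

lemma ascPochhammer_half (n : ℕ) :
    (ascPochhammer ℂ n).eval (1 / 2) * n.factorial * 4 ^ n = (2 * n).factorial := by
  induction n with
  | zero => simp
  | succ n ih =>
    rw [ascPochhammer_succ_eval, show 2 * (n + 1) = 2 * n + 1 + 1 by ring, Nat.factorial_succ (2 * n + 1),
      Nat.factorial_succ (2 * n), Nat.factorial_succ n]
    push_cast
    rw [← ih]; ring

lemma ascPochhammer_three_halves (n : ℕ) :
    (ascPochhammer ℂ n).eval (3 / 2) * n.factorial * 4 ^ n = (2 * n + 1).factorial := by
  induction n with
  | zero => simp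
  | succ n ih =>
    rw [ascPochhammer_succ_eval, show 2 * (n + 1) + 1 = 2 * n + 1 + 1 + 1 by ring, Nat.factorial_succ (2 * n + 1 + 1),
      Nat.factorial_succ (2 * n + 1), Nat.factorial_succ n]
    push_cast
    rw [← ih]; ring

/-- Serves both parities: `c` is `(2n)!` for `β = 1/2` and `(2n+1)!` for `β = 3/2`. -/
lemma hyp1F2_term {α β y : ℂ} {c : ℕ} (n : ℕ) (h : ∀ n : ℕ, α + 1 + n ≠ 0) (hα : α + n ≠ 0)
    (hβ : (ascPochhammer ℂ n).eval β * n.factorial * 4 ^ n = c) (hc : (c : ℂ) ≠ 0) :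
    (ascPochhammer ℂ n).eval α / ((ascPochhammer ℂ n).eval β * (ascPochhammer ℂ n).eval (α + 1)) *
      ((-(y ^ 2)) ^ n / (n.factorial : ℂ)) = α * ((2 * Complex.I * y) ^ (2 * n) / (c * (α + n))) := by
  have h1 := ascPochhammer_eval_ne_zero h n
  have h2 := ascPochhammer_eval_mul_add α n
  have hf : (n.factorial : ℂ) ≠ 0 := Nat.cast_ne_zero.2 n.factorial_ne_zero
  have hb : (ascPochhammer ℂ n).eval β ≠ 0 := by
    intro h0; rw [h0] at hβ; simp at hβ; exact hc hβ.symm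
  have h3 : (2 * Complex.I * y) ^ (2 * n) = 4 ^ n * (-(y ^ 2)) ^ n := by
    rw [pow_mul, ← mul_pow]; congr 1
    rw [mul_pow, mul_pow, Complex.I_sq]; ring
  rw [h3, ← hβ]
  generalize (-(y ^ 2)) ^ n = Y
  field_simp
  linear_combination Y * h2

lemma hyp1F2_even (y s : ℂ) (hs : ∀ n : ℕ, s ≠ n) :
    hyp1F2 (-s / 2) (1 / 2) (1 - s / 2) (-(y ^ 2))
      = -s * ∑' n : ℕ, (2 * Complex.I * y) ^ (2 * n) / ((2 * n).factorial * ((2 * n : ℕ) - s)) := by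
  rw [hyp1F2, ← tsum_mul_left]
  refine tsum_congr fun n => ?_
  have hne : ∀ n : ℕ, -s / 2 + n ≠ 0 := fun n h => hs (2 * n) (by push_cast; linear_combination -2 * h)
  have := hyp1F2_term (α := -s / 2) (y := y) n (fun m => by
    have := hne (m + 1)
    push_cast at this
    rwa [add_assoc, add_comm 1]) (hne n) (ascPochhammer_half n)
    (Nat.cast_ne_zero.2 (Nat.factorial_ne_zero _))
  rw [show 1 - s / 2 = -s / 2 + 1 by ring, this]
  have e : (-s / 2 + n) = (((2 * n : ℕ) : ℂ) - s) / 2 := by push_cast; ring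
  have hn2 : ((2 * n : ℕ) : ℂ) - s ≠ 0 := sub_ne_zero.2 (hs _).symm
  have hf : ((2 * n).factorial : ℂ) ≠ 0 := Nat.cast_ne_zero.2 (Nat.factorial_ne_zero _)
  rw [e]
  field_simp

lemma hyp1F2_odd (y s : ℂ) (hs : ∀ n : ℕ, s ≠ n) :
    2 * Complex.I * y * hyp1F2 ((1 - s) / 2) (3 / 2) (1 + (1 - s) / 2) (-(y ^ 2))
      = (1 - s) * ∑' n : ℕ,
        (2 * Complex.I * y) ^ (2 * n + 1) / ((2 * n + 1).factorial * ((2 * n + 1 : ℕ) - s)) := by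
  rw [hyp1F2, ← tsum_mul_left, ← tsum_mul_left]
  refine tsum_congr fun n => ?_
  have hne : ∀ n : ℕ, (1 - s) / 2 + n ≠ 0 := fun n h =>
    hs (2 * n + 1) (by push_cast; linear_combination -2 * h)
  have := hyp1F2_term (α := (1 - s) / 2) (y := y) n (fun m => by
    have := hne (m + 1)
    push_cast at this
    rwa [add_assoc, add_comm 1]) (hne n) (ascPochhammer_three_halves n)
    (Nat.cast_ne_zero.2 (Nat.factorial_ne_zero _))
  rw [show 1 + (1 - s) / 2 = (1 - s) / 2 + 1 by ring, this]
  have e : ((1 - s) / 2 + n) = (((2 * n + 1 : ℕ) : ℂ) - s) / 2 := by push_cast; ring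
  have hn2 : ((2 * n + 1 : ℕ) : ℂ) - s ≠ 0 := sub_ne_zero.2 (hs _).symm
  have hf : ((2 * n + 1).factorial : ℂ) ≠ 0 := Nat.cast_ne_zero.2 (Nat.factorial_ne_zero _)
  rw [e]
  field_simp
  ring

lemma lowerGammaSeries_eq_add (x s : ℂ) :
    lowerGammaSeries x s = ∑' n : ℕ, x ^ (2 * n) / ((2 * n).factorial * ((2 * n : ℕ) - s))
      + ∑' n : ℕ, x ^ (2 * n + 1) / ((2 * n + 1).factorial * ((2 * n + 1 : ℕ) - s)) := by
  have h := summable_lowerGammaSeries x s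
  exact (tsum_even_add_odd (f := fun n : ℕ => x ^ n / ((n.factorial : ℂ) * (n - s)))
    (h.comp_injective (mul_right_injective₀ two_ne_zero))
    (h.comp_injective fun a b hab => by simpa using hab)).symm

/-- The two hypergeometric functions as even and odd parts of the lower Gamma series. -/
lemma lowerGammaSeries_eq_hyp1F2 (y s : ℂ) (hs : ∀ n : ℕ, s ≠ n) :
    lowerGammaSeries (2 * Complex.I * y) s
      = -(1 / s) * hyp1F2 (-s / 2) (1 / 2) (1 - s / 2) (-(y ^ 2))
        + 2 * Complex.I * y / (1 - s) *
          hyp1F2 ((1 - s) / 2) (3 / 2) (1 + (1 - s) / 2) (-(y ^ 2)) := by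
  have h0 : s ≠ 0 := by simpa using hs 0
  have h1 : 1 - s ≠ 0 := sub_ne_zero.2 (by simpa using (hs 1).symm)
  rw [lowerGammaSeries_eq_add, div_mul_eq_mul_div, hyp1F2_odd y s hs, hyp1F2_even y s hs]
  field_simp

/-- The trigonometric combination of the hypergeometric functions in exponential form. -/
lemma hyp1F2_trig (y s : ℂ) (hs : ∀ n : ℕ, s ≠ n) (θ : ℝ) :
    (Real.sin θ : ℂ) * (1 / s) * hyp1F2 (-s / 2) (1 / 2) (1 - s / 2) (-(y ^ 2))
      - (Real.cos θ : ℂ) * (2 * y / (1 - s)) *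
          hyp1F2 ((1 - s) / 2) (3 / 2) (1 + (1 - s) / 2) (-(y ^ 2))
      = -(1 / (2 * Complex.I)) * (Complex.exp (Complex.I * θ) * lowerGammaSeries (2 * Complex.I * y) s
        - Complex.exp (-(Complex.I * θ)) * lowerGammaSeries (-(2 * Complex.I * y)) s) := by
  have e1 := lowerGammaSeries_eq_hyp1F2 y s hs
  -- Replacing `y` by `-y` flips only the odd part, so Euler's formula pairs the sine with the even
  -- part and the cosine with the odd part.
  have e2 := lowerGammaSeries_eq_hyp1F2 (-y) s hs
  rw [neg_sq] at e2
  have e3 : -(2 * Complex.I * y) = 2 * Complex.I * -y := by ring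
  have h1 : 1 - s ≠ 0 := sub_ne_zero.2 (by simpa using (hs 1).symm)
  have hc : Complex.exp (Complex.I * θ) = Real.cos θ + Real.sin θ * Complex.I := by
    rw [mul_comm, Complex.exp_mul_I, Complex.ofReal_cos, Complex.ofReal_sin]
  have hc' : Complex.exp (-(Complex.I * θ)) = Real.cos θ - Real.sin θ * Complex.I := by
    have : -(Complex.I * θ) = ((-θ : ℝ) : ℂ) * Complex.I := by push_cast; ring
    rw [this, Complex.exp_mul_I, ← Complex.ofReal_cos, ← Complex.ofReal_sin, Real.cos_neg,
      Real.sin_neg, Complex.ofReal_neg]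
    ring
  rw [e3, e1, e2, hc, hc']
  field_simp
  ring

/-! ### The `k`-th term: entire continuation, closed form, uniform decay. -/

/-- `i` times the sign of `a`. -/
noncomputable def axisUnit (a : ℝ) : ℂ := if 0 < a then Complex.I else -Complex.I

/-- The entire continuation of `k⁻¹ ∫_d^∞ sin(2πk(ax + b)) x^{-s-1} dx`. -/
noncomputable def fourierTail (a b d : ℝ) (k : ℕ) (s : ℂ) : ℂ :=
  1 / (2 * Complex.I * k) *
    (Complex.exp (Complex.I * (2 * π * b * k)) * oscTail (axisUnit a) (2 * π * k * |a|) d s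
      - Complex.exp (-(Complex.I * (2 * π * b * k))) * oscTail (-axisUnit a) (2 * π * k * |a|) d s)

lemma axisUnit_eq (a : ℝ) : axisUnit a = Complex.I ∨ axisUnit a = -Complex.I := by
  unfold axisUnit; split_ifs <;> simp

lemma neg_axisUnit_eq (a : ℝ) : -axisUnit a = Complex.I ∨ -axisUnit a = -Complex.I := by
  unfold axisUnit; split_ifs <;> simp

/-- The sign of `a` moves from the frequency to the direction of the ray, because the ray integral
decays only for positive frequency. -/
lemma axisUnit_mul_abs (a : ℝ) : axisUnit a * (|a| : ℝ) = Complex.I * a := by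
  unfold axisUnit
  split_ifs with h
  · rw [abs_of_pos h]
  · rw [abs_of_nonpos (not_lt.1 h)]; push_cast; ring

lemma frequency_pos {a : ℝ} (ha : a ≠ 0) {k : ℕ} (hk : 1 ≤ k) : 0 < 2 * π * k * |a| := by
  have : (0 : ℝ) < k := by exact_mod_cast hk
  positivity

lemma differentiable_fourierTail {a d : ℝ} (ha : a ≠ 0) (b : ℝ) (hd : 0 < d) {k : ℕ} (hk : 1 ≤ k) :
    Differentiable ℂ (fourierTail a b d k) :=
  (((differentiable_oscTail (axisUnit_eq a) (frequency_pos ha hk) hd).const_mul _).sub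
    ((differentiable_oscTail (neg_axisUnit_eq a) (frequency_pos ha hk) hd).const_mul _)).const_mul _

lemma hyperTerm_eq (a b : ℝ) {d : ℝ} (hd : 0 < d) {k : ℕ} (hk : 1 ≤ k) {s : ℂ}
    (hs : ∀ n : ℕ, s ≠ n) :
    hyperTerm a b d k s = -(1 / (2 * Complex.I * k) * ((d : ℂ) ^ (-s) *
      (Complex.exp (Complex.I * (2 * π * b * k)) * lowerGammaSeries (2 * π * k * a * Complex.I * d) s
      - Complex.exp (-(Complex.I * (2 * π * b * k))) *
          lowerGammaSeries (-(2 * π * k * a * Complex.I * d)) s))) := by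
  have h := hyp1F2_trig (π * a * d * k) s hs (2 * π * b * k)
  have hk0 : (k : ℂ) ≠ 0 := Nat.cast_ne_zero.2 (by lia)
  have hd0 : (d : ℂ) ≠ 0 := Complex.ofReal_ne_zero.2 hd.ne'
  have h0 : s ≠ 0 := by simpa using hs 0
  have h1 : 1 - s ≠ 0 := sub_ne_zero.2 (by simpa using (hs 1).symm)
  have e1 : -((π ^ 2 * a ^ 2 * d ^ 2 * (k : ℝ) ^ 2 : ℝ) : ℂ) = -((π * a * d * k : ℂ) ^ 2) := by
    push_cast; ring
  have e2 : 2 * Complex.I * (π * a * d * k : ℂ) = 2 * π * k * a * Complex.I * d := by ring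
  have e3 : ((2 * π * b * k : ℝ) : ℂ) = 2 * π * b * k := by push_cast; ring
  have e4 : (d : ℂ) ^ (1 - s) = (d : ℂ) ^ (-s) * d := by
    rw [sub_eq_neg_add, cpow_add_one_of_ne_zero _ hd0]
  have e5 : (d : ℂ) ^ s = ((d : ℂ) ^ (-s))⁻¹ := by rw [Complex.cpow_neg, inv_inv]
  have e6 : (d : ℂ) ^ (-s) ≠ 0 := by simp [Complex.cpow_eq_zero_iff, hd0]
  rw [e2, e3] at h
  unfold hyperTerm
  rw [e1, e4, e5]
  have e7 := congrArg (fun z => (d : ℂ) ^ (-s) / k * z) h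
  refine Eq.trans ?_ (e7.trans ?_)
  · field_simp
  · field_simp

/-- The positive factors `2π`, `k`, `|a|` leave arguments unchanged, so they split off from
principal powers and only `±axisUnit a` keeps its own power. -/
lemma gammaTerm_eq {a : ℝ} (ha : a ≠ 0) (b : ℝ) {k : ℕ} (hk : 1 ≤ k) (s : ℂ) :
    gammaTerm a b k s = 1 / (2 * Complex.I * k) *
      (Complex.exp (Complex.I * (2 * π * b * k)) *
          ((-axisUnit a) ^ s * ((2 * π * k * |a| : ℝ) : ℂ) ^ s * Complex.Gamma (-s))
      - Complex.exp (-(Complex.I * (2 * π * b * k))) *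
          ((axisUnit a) ^ s * ((2 * π * k * |a| : ℝ) : ℂ) ^ s * Complex.Gamma (-s))) := by
  have hk' : (0 : ℝ) < k := by exact_mod_cast hk
  have hk0 : (k : ℂ) ≠ 0 := Nat.cast_ne_zero.2 (by lia)
  have ha' : 0 < |a| := abs_pos.2 ha
  have hη0 : axisUnit a ≠ 0 := by rcases axisUnit_eq a with h | h <;> simp [h]
  have e1 : (Complex.I * a) ^ s = ((|a| : ℝ) : ℂ) ^ s * (axisUnit a) ^ s := by
    rw [← axisUnit_mul_abs, mul_comm, ofReal_mul_cpow ha' hη0]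
  have e2 : (-Complex.I * a) ^ s = ((|a| : ℝ) : ℂ) ^ s * (-axisUnit a) ^ s := by
    rw [neg_mul, ← axisUnit_mul_abs, ← neg_mul, mul_comm, ofReal_mul_cpow ha' (neg_ne_zero.2 hη0)]
  have e3 : ((2 * π * k * |a| : ℝ) : ℂ) ^ s = (2 * π : ℂ) ^ s * (k : ℂ) ^ s * ((|a| : ℝ) : ℂ) ^ s := by
    rw [Complex.ofReal_mul, Complex.mul_cpow_ofReal_nonneg (by positivity) ha'.le, Complex.ofReal_mul,
      Complex.mul_cpow_ofReal_nonneg (by positivity) hk'.le]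
    push_cast; rfl
  have e4 : (k : ℂ) ^ (s - 1) = (k : ℂ) ^ s / k := by
    rw [Complex.cpow_sub _ _ hk0, Complex.cpow_one]
  unfold gammaTerm
  rw [e1, e2, e3, e4]
  field_simp

lemma fourierTail_eq {a : ℝ} (ha : a ≠ 0) (b : ℝ) {d : ℝ} (hd : 0 < d) {k : ℕ} (hk : 1 ≤ k) {s : ℂ}
    (hs : ∀ n : ℕ, s ≠ n) : fourierTail a b d k s = hyperTerm a b d k s + gammaTerm a b k s := by
  have hω := frequency_pos ha hk
  have e : axisUnit a * ((2 * π * k * |a| : ℝ) : ℂ) * d = 2 * π * k * a * Complex.I * d := by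
    push_cast
    linear_combination 2 * π * k * d * axisUnit_mul_abs a
  rw [hyperTerm_eq a b hd hk hs, gammaTerm_eq ha b hk, fourierTail, oscTail_eq (axisUnit_eq a) hω hd s hs,
    oscTail_eq (neg_axisUnit_eq a) hω hd s hs, neg_neg, neg_mul, neg_mul, e]
  ring

/-- Uniform quadratic decay of the Fourier tails. -/
lemma exists_norm_fourierTail_le {c : ℝ} (ε : ℝ) (hc : 0 < c) :
    ∃ M : ℝ, 0 < M ∧ ∀ a b d : ℝ, c ≤ |a| → c ≤ d → ∀ s : ℂ, -ε ≤ s.re → |s.im| ≤ ε → ∀ k : ℕ,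
      ‖fourierTail a b d (k + 1) s‖ ≤ d ^ (-s.re) * (M * (1 / ((k + 1 : ℕ) : ℝ) ^ 2)) := by
  obtain ⟨M, hM, h⟩ := exists_norm_rayIntegral_le (ε := ε) hc (show 0 < 2 * π * c by positivity)
  refine ⟨M / (2 * π * c), by positivity, fun a b d ha hd s hs1 hs2 k => ?_⟩
  have hk : (0 : ℝ) < ((k + 1 : ℕ) : ℝ) := by positivity
  have hk1 : (1 : ℝ) ≤ ((k + 1 : ℕ) : ℝ) := by exact_mod_cast Nat.le_add_left 1 k
  have hd0 : 0 < d := hc.trans_le hd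
  have hω : 2 * π * c ≤ 2 * π * ((k + 1 : ℕ) : ℝ) * |a| := by
    rw [mul_assoc (2 * π)]
    gcongr
    nlinarith
  -- The frequency is at least `2πck`, so the ray integral yields one factor `1/k`; the prefactor
  -- `1/(2ik)` yields the other.
  have hω2 : 2 * π * c * ((k + 1 : ℕ) : ℝ) ≤ 2 * π * ((k + 1 : ℕ) : ℝ) * |a| := by
    rw [mul_right_comm]; gcongr
  have hb : ∀ η : ℂ, (η = Complex.I ∨ η = -Complex.I) →
      ‖oscTail η (2 * π * ((k + 1 : ℕ) : ℝ) * |a|) d s‖ ≤ M * d ^ (-s.re) / (2 * π * c * ((k + 1 : ℕ) : ℝ)) := by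
    intro η hη
    rw [norm_oscTail hη]
    refine (h η hη d hd s hs1 hs2 _ hω).trans ?_
    gcongr
  have hE : ∀ σ : ℝ, ‖Complex.exp (Complex.I * σ)‖ = 1 := fun σ => by
    rw [mul_comm, Complex.norm_exp_ofReal_mul_I]
  have e1 : Complex.I * (2 * π * b * ((k + 1 : ℕ) : ℂ)) = Complex.I * ((2 * π * b * ((k + 1 : ℕ) : ℝ) : ℝ) : ℂ) := by
    push_cast; ring
  have e2 : -(Complex.I * (2 * π * b * ((k + 1 : ℕ) : ℂ))) = Complex.I * ((-(2 * π * b * ((k + 1 : ℕ) : ℝ)) : ℝ) : ℂ) := by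
    push_cast; ring
  unfold fourierTail
  rw [norm_mul, e2, e1]
  have h1 := (norm_sub_le (Complex.exp (Complex.I * ((2 * π * b * ((k + 1 : ℕ) : ℝ) : ℝ) : ℂ)) *
      oscTail (axisUnit a) (2 * π * ((k + 1 : ℕ) : ℝ) * |a|) d s)
    (Complex.exp (Complex.I * ((-(2 * π * b * ((k + 1 : ℕ) : ℝ)) : ℝ) : ℂ)) *
      oscTail (-axisUnit a) (2 * π * ((k + 1 : ℕ) : ℝ) * |a|) d s))
  rw [norm_mul, norm_mul, hE, hE, one_mul, one_mul] at h1
  have h2 := h1.trans (add_le_add (hb _ (axisUnit_eq a)) (hb _ (neg_axisUnit_eq a)))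
  have h3 : ‖1 / (2 * Complex.I * ((k + 1 : ℕ) : ℂ))‖ = 1 / (2 * ((k + 1 : ℕ) : ℝ)) := by
    rw [norm_div, norm_mul, norm_mul, Complex.norm_natCast]; simp
  rw [h3]
  refine (mul_le_mul_of_nonneg_left h2 (by positivity)).trans (le_of_eq ?_)
  field_simp
  ring

lemma summable_const_mul_inv_sq (M : ℝ) : Summable fun k : ℕ => M * (1 / ((k + 1 : ℕ) : ℝ) ^ 2) :=
  ((summable_nat_add_iff 1).2 (Real.summable_one_div_nat_pow.2 one_lt_two)).mul_left M

/-- The Weierstrass M-test. -/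
lemma absUnifConvOn_of_le {X : Type*} {f : ℕ → X → ℂ} {S : Set X} {u : ℕ → ℝ} (hu : Summable u)
    (h : ∀ k, ∀ x ∈ S, ‖f k x‖ ≤ u k) : AbsUnifConvOn f S :=
  ⟨fun x hx => hu.of_nonneg_of_le (fun _ => norm_nonneg _) fun k => h k x hx,
    tendstoUniformlyOn_tsum_nat hu fun k x hx => by rw [norm_norm]; exact h k x hx,
    tendstoUniformlyOn_tsum_nat hu h⟩

lemma absUnifConvOn_scaled_fourierTail {c C ε : ℝ} (hc : 0 < c) :
    AbsUnifConvOn (fun k (p : ℝ × ℝ × ℝ × ℂ) =>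
      (p.2.2.1 : ℂ) ^ p.2.2.2 * fourierTail p.1 p.2.1 p.2.2.1 (k + 1) p.2.2.2)
      (paramRegion c C ε) := by
  obtain ⟨M, hM, h⟩ := exists_norm_fourierTail_le ε hc
  refine absUnifConvOn_of_le (summable_const_mul_inv_sq M) ?_
  rintro k ⟨a, b, d, s⟩ ⟨⟨ha, _⟩, ⟨hd, _⟩, hs1, hs2⟩
  have hd0 : 0 < d := hc.trans_le hd
  have hb := h a b d ha hd s hs1.le hs2.le k
  simp only
  rw [norm_mul, norm_ofReal_cpow_of_pos hd0]
  calc d ^ s.re * ‖fourierTail a b d (k + 1) s‖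
      ≤ d ^ s.re * (d ^ (-s.re) * (M * (1 / ((k + 1 : ℕ) : ℝ) ^ 2))) := by gcongr
    _ = _ := by rw [← mul_assoc, ← rpow_add hd0, add_neg_cancel, rpow_zero, one_mul]

lemma absUnifConvOn_fourierTail {c C ε : ℝ} (hc : 0 < c) (hε : 0 < ε) (B : ℝ) :
    AbsUnifConvOn (fun k (p : ℝ × ℝ × ℝ × ℂ) => fourierTail p.1 p.2.1 p.2.2.1 (k + 1) p.2.2.2)
      (paramRegion c C ε ∩ {p | 1 ≤ p.2.2.1 ∨ p.2.2.2.re ≤ B}) := by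
  obtain ⟨M, hM, h⟩ := exists_norm_fourierTail_le ε hc
  -- One summand for each case: `d ≥ 1` with `Re s > -ε`; `d ≤ 1` with `Re s ≤ 0`; and `c ≤ d ≤ 1`
  -- with `0 ≤ Re s ≤ B`.
  set D := |C| ^ ε + 1 + (c⁻¹) ^ |B| with hD
  refine absUnifConvOn_of_le ((summable_const_mul_inv_sq M).mul_left D) ?_
  rintro k ⟨a, b, d, s⟩ ⟨⟨⟨ha, _⟩, ⟨hd, hdC⟩, hs1, hs2⟩, hB⟩
  have hd0 : 0 < d := hc.trans_le hd
  simp only at hs1 hs2 hB hd hdC ha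
  refine (h a b d ha hd s hs1.le hs2.le k).trans ?_
  refine mul_le_mul_of_nonneg_right ?_ (by positivity)
  have p1 : 0 ≤ |C| ^ ε := by positivity
  have p2 : 0 ≤ (c⁻¹) ^ |B| := by positivity
  rcases le_total 1 d with h1 | h1
  · have : d ^ (-s.re) ≤ |C| ^ ε :=
      (rpow_le_rpow_of_exponent_le h1 (by linarith)).trans
        (rpow_le_rpow hd0.le (hdC.trans (le_abs_self C)) hε.le)
    linarith
  · rcases le_total s.re 0 with h2 | h2
    · have : d ^ (-s.re) ≤ 1 := rpow_le_one hd0.le h1 (by linarith)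
      linarith
    · have hdi : 1 ≤ d⁻¹ := (one_le_inv₀ hd0).2 h1
      have hle : s.re ≤ |B| ∨ d = 1 := by
        simp only [mem_ofPred_eq] at hB
        rcases hB with hB | hB
        · exact Or.inr (le_antisymm h1 hB)
        · exact Or.inl (hB.trans (le_abs_self B))
      rcases hle with hle | rfl
      · have : d ^ (-s.re) ≤ (c⁻¹) ^ |B| := by
          rw [rpow_neg hd0.le, ← inv_rpow hd0.le]
          exact (rpow_le_rpow_of_exponent_le hdi hle).trans
            (rpow_le_rpow (by positivity) (inv_anti₀ hc hd) (abs_nonneg B))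
        linarith
      · rw [one_rpow]; linarith

/-- A majorant on each disc `‖s‖ < R`, as needed for the sum to be entire. -/
lemma exists_norm_fourierTail_le_on_square {a d : ℝ} (ha : a ≠ 0) (b : ℝ) (hd : 0 < d) (R : ℝ) :
    ∃ u : ℕ → ℝ, Summable u ∧ ∀ k : ℕ, ∀ s : ℂ, ‖s‖ < R → ‖fourierTail a b d (k + 1) s‖ ≤ u k := by
  have hc : 0 < min |a| d := lt_min (abs_pos.2 ha) hd
  obtain ⟨M, hM, h⟩ := exists_norm_fourierTail_le R hc
  refine ⟨fun k => (d ^ R + d ^ (-R)) * (M * (1 / ((k + 1 : ℕ) : ℝ) ^ 2)),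
    (summable_const_mul_inv_sq M).mul_left _, fun k s hs => ?_⟩
  have hre := (Complex.abs_re_le_norm s).trans hs.le
  have him := (Complex.abs_im_le_norm s).trans hs.le
  rw [abs_le] at hre
  refine (h a b d (min_le_left _ _) (min_le_right _ _) s hre.1 him k).trans ?_
  refine mul_le_mul_of_nonneg_right ?_ (by positivity)
  rcases le_total 1 d with h1 | h1
  · linarith [rpow_le_rpow_of_exponent_le h1 (show -s.re ≤ R by linarith), rpow_pos_of_pos hd (-R)]
  · linarith [rpow_le_rpow_of_exponent_ge hd h1 (show -R ≤ -s.re by linarith), rpow_pos_of_pos hd R]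

lemma summable_norm_fourierTail {a d : ℝ} (ha : a ≠ 0) (b : ℝ) (hd : 0 < d) (s : ℂ) :
    Summable fun k : ℕ => ‖fourierTail a b d (k + 1) s‖ := by
  obtain ⟨u, hu, h⟩ := exists_norm_fourierTail_le_on_square ha b hd (‖s‖ + 1)
  exact hu.of_nonneg_of_le (fun _ => norm_nonneg _) fun k => h k s (lt_add_one _)

lemma differentiable_tsum_fourierTail {a d : ℝ} (ha : a ≠ 0) (b : ℝ) (hd : 0 < d) :
    Differentiable ℂ fun s => ∑' k : ℕ, fourierTail a b d (k + 1) s := by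
  intro s
  obtain ⟨u, hu, h⟩ := exists_norm_fourierTail_le_on_square ha b hd (‖s‖ + 1)
  have hU : IsOpen {z : ℂ | ‖z‖ < ‖s‖ + 1} := isOpen_lt continuous_norm continuous_const
  exact (Complex.differentiableOn_tsum_of_summable_norm hu
    (fun k => (differentiable_fourierTail ha b hd (Nat.le_add_left 1 k)).differentiableOn) hU h).differentiableAt
    (hU.mem_nhds (by simp))

/-! ### The sum of the series: sawtooth integral and Hurwitz zeta function. -/

lemma fourierTail_eq_integral {a d : ℝ} (ha : a ≠ 0) (b : ℝ) (hd : 0 < d) {k : ℕ} (hk : 1 ≤ k) {s : ℂ}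
    (hs : 0 < s.re) :
    fourierTail a b d k s
      = ∫ x in Ioi d, ((sin (2 * π * k * (a * x + b)) / k : ℝ) : ℂ) * (x : ℂ) ^ (-s - 1) := by
  have hω := frequency_pos ha hk
  have hk0 : (k : ℂ) ≠ 0 := Nat.cast_ne_zero.2 (by lia)
  have i1 := (integrableOn_osc (axisUnit_eq a) (2 * π * k * |a|) hd hs).const_mul
    (Complex.exp (Complex.I * (2 * π * b * k)))
  have i2 := (integrableOn_osc (neg_axisUnit_eq a) (2 * π * k * |a|) hd hs).const_mul
    (Complex.exp (-(Complex.I * (2 * π * b * k))))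
  rw [fourierTail, oscTail_eq_integral (axisUnit_eq a) hω hd hs,
    oscTail_eq_integral (neg_axisUnit_eq a) hω hd hs, ← integral_const_mul, ← integral_const_mul,
    ← integral_sub i1 i2, ← integral_const_mul]
  refine integral_congr_ae (Eventually.of_forall fun x => ?_)
  simp only
  have e : axisUnit a * ((2 * π * k * |a| : ℝ) : ℂ) * x = Complex.I * (2 * π * k * a * x) := by
    push_cast
    linear_combination 2 * π * k * x * axisUnit_mul_abs a
  rw [neg_mul, neg_mul, e, ← mul_assoc (Complex.exp _), ← mul_assoc (Complex.exp _), ← Complex.exp_add, ← Complex.exp_add]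
  have e1 : Complex.I * (2 * π * b * k) + Complex.I * (2 * π * k * a * x)
      = (2 * π * k * (a * x + b)) * Complex.I := by ring
  have e2 : -(Complex.I * (2 * π * b * k)) + -(Complex.I * (2 * π * k * a * x))
      = -(2 * π * k * (a * x + b)) * Complex.I := by ring
  have e3 : ((sin (2 * π * k * (a * x + b)) / k : ℝ) : ℂ)
      = Complex.sin (2 * π * k * (a * x + b)) / k := by push_cast; rfl
  rw [e1, e2, e3, Complex.sin]
  field_simp
  rw [Complex.I_sq]
  ring

lemma sum_fourierTail_eq_integral {a d : ℝ} (ha : a ≠ 0) (b : ℝ) (hd : 0 < d) {s : ℂ}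
    (hs : 0 < s.re) (N : ℕ) :
    ∑ k ∈ Finset.range N, fourierTail a b d (k + 1) s
      = ∫ x in Ioi d, (sawSum N (a * x + b) : ℂ) * (x : ℂ) ^ (-s - 1) := by
  have hint : ∀ k : ℕ, IntegrableOn
      (fun x : ℝ => ((sin (2 * π * k * (a * x + b)) / k : ℝ) : ℂ) * (x : ℂ) ^ (-s - 1)) (Ioi d) := by
    intro k
    have h0 := integrableOn_Ioi_cpow_of_lt (a := -s - 1) (by simp; linarith) hd
    refine Integrable.bdd_mul (c := 1 / k) h0
      (by fun_prop : Continuous fun x : ℝ => ((sin (2 * π * k * (a * x + b)) / k : ℝ) : ℂ)).aestronglyMeasurable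
      (Eventually.of_forall fun x => ?_)
    rw [Complex.norm_real, norm_div, Real.norm_eq_abs, RCLike.norm_natCast]
    gcongr
    exact abs_sin_le_one _
  rw [Finset.sum_congr rfl fun k _ => fourierTail_eq_integral ha b hd (Nat.le_add_left 1 k) hs,
    ← integral_finsetSum _ fun k _ => hint (k + 1)]
  refine integral_congr_ae (Eventually.of_forall fun x => ?_)
  simp only [sawSum]
  rw [Complex.ofReal_sum, Finset.sum_mul]
  push_cast
  rfl

lemma measurable_saw : Measurable saw :=
  Measurable.ite (measurable_fract (measurableSet_singleton 0)) measurable_const (by fun_prop)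

/-- Dominated convergence: the sawtooth partial sums are bounded by `8`, and `x^{-s-1}` is
integrable on `(d, ∞)`. -/
lemma tsum_fourierTail_eq_integral {a d : ℝ} (ha : a ≠ 0) (b : ℝ) (hd : 0 < d) {s : ℂ}
    (hs : 0 < s.re) :
    ∑' k : ℕ, fourierTail a b d (k + 1) s
      = ∫ x in Ioi d, (saw (a * x + b) : ℂ) * (x : ℂ) ^ (-s - 1) := by
  have h0 := integrableOn_Ioi_cpow_of_lt (a := -s - 1) (by simp; linarith) hd
  have h1 := (summable_norm_fourierTail ha b hd s).of_norm.hasSum.tendsto_sum_nat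
  simp_rw [sum_fourierTail_eq_integral ha b hd hs] at h1
  refine tendsto_nhds_unique h1 ?_
  refine tendsto_integral_filter_of_dominated_convergence (fun x => 8 * ‖(x : ℂ) ^ (-s - 1)‖) ?_ ?_
    (h0.norm.const_mul 8) ?_
  · refine Eventually.of_forall fun N => ?_
    have : Continuous fun x : ℝ => (sawSum N (a * x + b) : ℂ) :=
      Complex.continuous_ofReal.comp ((continuous_sawSum N).comp (by fun_prop))
    exact this.aestronglyMeasurable.mul h0.aestronglyMeasurable
  · refine Eventually.of_forall fun N => Eventually.of_forall fun x => ?_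
    rw [norm_mul, Complex.norm_real, Real.norm_eq_abs]
    gcongr
    exact abs_sawSum_le _ _
  · refine Eventually.of_forall fun x => Tendsto.mul_const _ ?_
    exact (Complex.continuous_ofReal.tendsto _).comp (tendsto_sawSum _)

/-- The formula can fail only where `ax + b` is an integer, a countable set. Replacing `b` by `{b}`
is an integer shift and leaves the fractional part unchanged. -/
lemma ae_saw_eq {a : ℝ} (ha : a ≠ 0) (b : ℝ) :
    ∀ᵐ x : ℝ, saw (a * x + b)
      = π * (1 / 2 - Int.fract b - a * x + ⌊a * x + Int.fract b⌋) := by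
  have hc : (range fun m : ℤ => ((m : ℝ) - b) / a).Countable := countable_range _
  filter_upwards [hc.ae_notMem volume] with x hx
  have hf : Int.fract (a * x + b) ≠ 0 := by
    intro h
    obtain ⟨m, hm⟩ := Int.fract_eq_zero_iff.1 h
    exact hx ⟨m, by simp only [hm]; field_simp; ring⟩
  have e : Int.fract (a * x + b) = Int.fract (a * x + Int.fract b) := by
    conv_lhs => rw [← Int.fract_add_floor b, ← add_assoc, Int.fract_add_intCast]
  rw [saw, if_neg hf, e, ← Int.self_sub_floor (a * x + Int.fract b)]
  ring

lemma measurable_floor_linear (a β : ℝ) : Measurable fun x : ℝ => (⌊a * x + β⌋ : ℂ) := by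
  have : Measurable fun x : ℝ => ⌊a * x + β⌋ := by fun_prop
  exact (measurable_of_countable (fun n : ℤ => (n : ℂ))).comp this

lemma abs_floor_le (y : ℝ) : |(⌊y⌋ : ℝ)| ≤ |y| + 1 := by
  have h1 := Int.floor_le y
  have h2 := Int.lt_floor_add_one y
  rw [abs_le]
  constructor <;> cases abs_cases y <;> linarith

lemma integrableOn_floor_mul_cpow (a β : ℝ) {d : ℝ} (hd : 0 < d) {s : ℂ} (hs : 1 < s.re) :
    IntegrableOn (fun x : ℝ => (⌊a * x + β⌋ : ℂ) * (x : ℂ) ^ (-s - 1)) (Ioi d) := by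
  have h0 := integrableOn_Ioi_cpow_of_lt (a := -s - 1) (by simp; linarith) hd
  have h1 := integrableOn_Ioi_rpow_of_lt (a := -s.re) (by linarith) hd
  refine Integrable.mono' ((h1.const_mul |a|).add (h0.norm.const_mul (|β| + 1)))
    ((measurable_floor_linear a β).aestronglyMeasurable.mul h0.aestronglyMeasurable) ?_
  refine (ae_restrict_iff' measurableSet_Ioi).2 (Eventually.of_forall fun x hx => ?_)
  have hx0 : 0 < x := hd.trans hx
  have hn : ‖(⌊a * x + β⌋ : ℂ)‖ ≤ |a| * x + (|β| + 1) := by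
    have : ((⌊a * x + β⌋ : ℝ) : ℂ) = (⌊a * x + β⌋ : ℂ) := by push_cast; rfl
    rw [← this, Complex.norm_real, Real.norm_eq_abs]
    refine (abs_floor_le _).trans ?_
    have := abs_add_le (a * x) β
    rw [abs_mul, abs_of_pos hx0] at this
    linarith
  simp only [Pi.add_apply]
  rw [norm_mul]
  refine (mul_le_mul_of_nonneg_right hn (norm_nonneg _)).trans (le_of_eq ?_)
  rw [add_mul, norm_ofReal_cpow_of_pos hx0]
  have : x ^ (-s.re) = x * x ^ (-s - 1).re := by
    have : (-s - 1).re = -s.re - 1 := by simp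
    rw [this, rpow_sub_one hx0.ne']; field_simp
  rw [this]; ring

/-- The floor counts its jump points `(n + 1 - β)/a`, `n ≥ 0`, that lie at or below `x`. -/
lemma tsum_indicator_floor {a β x : ℝ} (ha : 0 < a) (c : ℂ) (hx : 0 ≤ a * x + β) :
    ∑' n : ℕ, (Ici ((n + (1 - β)) / a)).indicator (fun _ => c) x = (⌊a * x + β⌋ : ℂ) * c := by
  obtain ⟨m, hm⟩ := Int.eq_ofNat_of_zero_le (Int.floor_nonneg.2 hx)
  have hiff : ∀ n : ℕ, x ∈ Ici (((n : ℝ) + (1 - β)) / a) ↔ n < m := by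
    intro n
    rw [mem_Ici, div_le_iff₀ ha]
    have h1 : (n : ℝ) + (1 - β) ≤ x * a ↔ (((n + 1 : ℕ) : ℤ) : ℝ) ≤ a * x + β := by
      push_cast
      constructor <;> intro <;> linarith
    rw [h1, ← Int.le_floor, hm]
    norm_cast
  rw [tsum_eq_sum (s := Finset.range m)]
  · rw [Finset.sum_congr rfl fun n hn => indicator_of_mem ((hiff n).2 (Finset.mem_range.1 hn)) _, hm]
    simp
  · intro n hn
    exact indicator_of_notMem (fun h => hn (Finset.mem_range.2 ((hiff n).1 h))) _

/-- The Mellin transform of the floor function is a Hurwitz zeta function. -/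
lemma integral_floor_mul_cpow {a β : ℝ} (ha : 0 < a) (h0 : 0 ≤ β) (h1 : β < 1) {s : ℂ} (hs : 1 < s.re) :
    ∫ x in Ioi (0 : ℝ), (⌊a * x + β⌋ : ℂ) * (x : ℂ) ^ (-s - 1)
      = (a : ℂ) ^ s / s * HurwitzZeta.hurwitzZeta ((1 - β : ℝ) : UnitAddCircle) s := by
  have hs0 : s ≠ 0 := by rintro rfl; simp at hs; linarith
  have hre : (-s - 1).re = -s.re - 1 := by simp
  have hz := HurwitzZeta.hasSum_hurwitzZeta_of_one_lt_re (a := 1 - β) ⟨by linarith, by linarith⟩ hs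
  set p : ℕ → ℝ := fun n => (n + (1 - β)) / a with hp
  have hn0 : ∀ n : ℕ, 0 < (n : ℝ) + (1 - β) := fun n => by
    have : (0 : ℝ) ≤ n := n.cast_nonneg
    linarith
  have hp0 : ∀ n, 0 < p n := fun n => div_pos (hn0 n) ha
  have hpow : ∀ n, ((p n : ℝ) : ℂ) ^ (-s) = (a : ℂ) ^ s * (1 / ((n : ℂ) + (1 - β : ℝ)) ^ s) := by
    intro n
    have e : ((n : ℂ) + (1 - β : ℝ)) = (((n : ℝ) + (1 - β) : ℝ) : ℂ) := by push_cast; ring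
    have ha0 : (a : ℂ) ^ s ≠ 0 := by simp [Complex.cpow_eq_zero_iff, ha.ne']
    have hn0' : (((n : ℝ) + (1 - β) : ℝ) : ℂ) ^ s ≠ 0 := by
      rw [Ne, Complex.cpow_eq_zero_iff]; exact fun h => (hn0 n).ne' (Complex.ofReal_eq_zero.1 h.1)
    rw [e, hp, Complex.cpow_neg, Complex.ofReal_div, Complex.div_cpow_ofReal_nonneg (hn0 n).le ha.le]
    field_simp
  set F : ℕ → ℝ → ℂ := fun n => (Ici (p n)).indicator fun x => (x : ℂ) ^ (-s - 1) with hF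
  have hset : ∀ n, Ici (p n) ∩ Ioi 0 = Ici (p n) := fun n =>
    inter_eq_left.2 fun x hx => (hp0 n).trans_le hx
  have hI : ∀ n, IntegrableOn (fun x : ℝ => (x : ℂ) ^ (-s - 1)) (Ici (p n)) := fun n => by
    rw [integrableOn_Ici_iff_integrableOn_Ioi]
    exact integrableOn_Ioi_cpow_of_lt (by rw [hre]; linarith) (hp0 n)
  have hFint : ∀ n, Integrable (F n) (volume.restrict (Ioi 0)) := fun n =>
    ((integrable_indicator_iff measurableSet_Ici).2 (hI n)).restrict
  have hval : ∀ n, ∫ x in Ioi (0 : ℝ), F n x = (a : ℂ) ^ s / s * (1 / ((n : ℂ) + (1 - β : ℝ)) ^ s) := by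
    intro n
    rw [hF]
    simp only
    rw [integral_indicator measurableSet_Ici, Measure.restrict_restrict measurableSet_Ici, hset,
      integral_Ici_eq_integral_Ioi, integral_Ioi_cpow_of_lt (by rw [hre]; linarith) (hp0 n),
      sub_add_cancel, hpow]
    field_simp
  have hnorm : ∀ n, ∫ x in Ioi (0 : ℝ), ‖F n x‖
      = ‖(a : ℂ) ^ s‖ / s.re * ‖1 / ((n : ℂ) + (1 - β : ℝ)) ^ s‖ := by
    intro n
    rw [hF]
    simp only [norm_indicator_eq_indicator_norm]
    rw [integral_indicator measurableSet_Ici, Measure.restrict_restrict measurableSet_Ici, hset,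
      integral_Ici_eq_integral_Ioi,
      setIntegral_congr_fun (g := fun x : ℝ => x ^ (-s.re - 1)) measurableSet_Ioi
        fun x hx => by rw [← hre]; exact norm_ofReal_cpow_of_pos ((hp0 n).trans hx) _,
      integral_Ioi_rpow_of_lt (by linarith) (hp0 n), sub_add_cancel, div_mul_eq_mul_div, ← norm_mul,
      ← hpow, norm_ofReal_cpow_of_pos (hp0 n), Complex.neg_re, neg_div_neg_eq]
  -- The norms sum to a multiple of the absolute Hurwitz series, so sum and integral may be
  -- exchanged.
  have key := hasSum_integral_of_summable_integral_norm hFint (by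
    simp_rw [hnorm]; exact hz.summable.norm.mul_left _)
  simp_rw [hval] at key
  rw [(hz.mul_left ((a : ℂ) ^ s / s)).unique key]
  refine setIntegral_congr_fun measurableSet_Ioi fun x hx => ?_
  have hx0 : (0 : ℝ) < x := hx
  rw [← tsum_indicator_floor ha ((x : ℂ) ^ (-s - 1)) (by positivity)]
  rfl

/-- The floor vanishes on `(0, (1-{b})/a)`, so the zeta term is the integral from the first jump;
`floorRemainder` changes that lower limit to `d`, through the base point `1`. -/
lemma integral_Ioi_floor_eq {a : ℝ} (ha : 0 < a) (b : ℝ) {d : ℝ} (hd : 0 < d) {s : ℂ} (hs : 1 < s.re) :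
    s * ∫ x in Ioi d, (⌊a * x + Int.fract b⌋ : ℂ) * (x : ℂ) ^ (-s - 1)
      = (a : ℂ) ^ s * HurwitzZeta.hurwitzZeta ((1 - Int.fract b : ℝ) : UnitAddCircle) s
        + floorRemainder a b d s := by
  have hs0 : s ≠ 0 := by rintro rfl; simp at hs; linarith
  have hβ0 := Int.fract_nonneg b
  have hβ1 := Int.fract_lt_one b
  set β := Int.fract b with hβ
  have hx0 : 0 < (1 - β) / a := div_pos (by linarith) ha
  have i := fun {c : ℝ} (hc : 0 < c) => integrableOn_floor_mul_cpow a β hc hs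
  have k1 := intervalIntegral.integral_interval_add_Ioi (i one_pos) (i hx0)
  have k2 := intervalIntegral.integral_interval_add_Ioi (i one_pos) (i hd)
  have k3 := integral_floor_mul_cpow ha hβ0 hβ1 hs
  have k4 : ∫ x in Ioi (0 : ℝ), (⌊a * x + β⌋ : ℂ) * (x : ℂ) ^ (-s - 1)
      = ∫ x in Ici ((1 - β) / a), (⌊a * x + β⌋ : ℂ) * (x : ℂ) ^ (-s - 1) := by
    refine setIntegral_eq_of_subset_of_forall_sdiff_eq_zero measurableSet_Ioi
      (fun x hx => hx0.trans_le hx) fun x hx => ?_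
    have h1 : (0 : ℝ) < x := hx.1
    have h2 : x < (1 - β) / a := not_le.1 hx.2
    rw [lt_div_iff₀ ha] at h2
    have : ⌊a * x + β⌋ = 0 := Int.floor_eq_zero_iff.2 ⟨by positivity, by linarith⟩
    rw [this]; simp
  rw [integral_Ici_eq_integral_Ioi] at k4
  have k5 : (a : ℂ) ^ s * HurwitzZeta.hurwitzZeta ((1 - β : ℝ) : UnitAddCircle) s
      = s * ∫ x in Ioi ((1 - β) / a), (⌊a * x + β⌋ : ℂ) * (x : ℂ) ^ (-s - 1) := by
    rw [← k4, k3]; field_simp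
  rw [k5, floorRemainder, ← hβ]
  linear_combination s * (k2 - k1)

/-- The sawtooth is split into constant, linear and floor parts; the last two are separately
integrable only because `Re s > 1`. -/
lemma zetaSide_eq_tsum_of_pos {a : ℝ} (ha : 0 < a) (b : ℝ) {d : ℝ} (hd : 0 < d) {s : ℂ} (hs : 1 < s.re) :
    zetaSide a b d s = ∑' k : ℕ, fourierTail a b d (k + 1) s := by
  have hs0 : s ≠ 0 := by rintro rfl; simp at hs; linarith
  have hs1 : s - 1 ≠ 0 := fun h => by
    rw [sub_eq_zero.1 h] at hs; simp at hs
  have hd0 : (d : ℂ) ≠ 0 := Complex.ofReal_ne_zero.2 hd.ne'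
  rw [tsum_fourierTail_eq_integral ha.ne' b hd (by linarith)]
  have i0 := integrableOn_Ioi_cpow_of_lt (a := -s - 1) (by simp; linarith) hd
  have i1 := integrableOn_Ioi_cpow_of_lt (a := -s) (by simp; linarith) hd
  have i2 := integrableOn_floor_mul_cpow a (Int.fract b) hd hs
  have e : ∫ x in Ioi d, (saw (a * x + b) : ℂ) * (x : ℂ) ^ (-s - 1)
      = ∫ x in Ioi d, ((π * (1 / 2 - Int.fract b) : ℂ) * (x : ℂ) ^ (-s - 1) - (π * a : ℂ) * (x : ℂ) ^ (-s)
        + π * ((⌊a * x + Int.fract b⌋ : ℂ) * (x : ℂ) ^ (-s - 1))) := by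
    refine setIntegral_congr_ae measurableSet_Ioi ?_
    filter_upwards [ae_saw_eq ha.ne' b] with x hx hxd
    have hx0 : (x : ℂ) ≠ 0 := Complex.ofReal_ne_zero.2 (hd.trans hxd).ne'
    have : (x : ℂ) ^ (-s) = x * (x : ℂ) ^ (-s - 1) := by
      rw [mul_comm, ← cpow_add_one_of_ne_zero _ hx0, sub_add_cancel]
    rw [hx, this]
    push_cast; ring
  have i3 : IntegrableOn (fun x : ℝ => (π * (1 / 2 - Int.fract b) : ℂ) * (x : ℂ) ^ (-s - 1)
      - (π * a : ℂ) * (x : ℂ) ^ (-s)) (Ioi d) := (i0.const_mul _).sub (i1.const_mul _)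
  rw [e, integral_add i3 (i2.const_mul _),
    integral_sub (i0.const_mul _) (i1.const_mul _), integral_const_mul, integral_const_mul,
    integral_const_mul, integral_Ioi_cpow_of_lt (by simp; linarith) hd,
    integral_Ioi_cpow_of_lt (by simp; linarith) hd]
  have k := integral_Ioi_floor_eq ha b hd hs
  have k' : ∫ x in Ioi d, (⌊a * x + Int.fract b⌋ : ℂ) * (x : ℂ) ^ (-s - 1)
      = ((a : ℂ) ^ s * HurwitzZeta.hurwitzZeta ((1 - Int.fract b : ℝ) : UnitAddCircle) s
        + floorRemainder a b d s) / s := by rw [← k]; field_simp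
  have hs2 : -s + 1 ≠ 0 := fun h => hs1 (by linear_combination -h)
  rw [k', zetaSide, if_pos ha, sub_add_cancel, cpow_add_one_of_ne_zero _ hd0]
  have e2 : (-s + 1) = -(s - 1) := by ring
  rw [e2]
  field_simp
  ring

/-- The sawtooth is odd, so changing the signs of `a` and `b` negates both sides of the identity;
this reduces `a < 0` to `a > 0`. -/
lemma zetaSide_neg_neg {a : ℝ} (ha : a < 0) (b d : ℝ) (s : ℂ) :
    zetaSide a b d s = -zetaSide (-a) (-b) d s := by
  rw [zetaSide, zetaSide, if_neg (not_lt.2 ha.le), if_pos (neg_pos.2 ha)]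
  have : (a * d * s / (1 - s) : ℂ) = ((-a : ℝ) : ℂ) * d * s / (s - 1) := by
    rw [← neg_sub s 1, div_neg, ← neg_div]; push_cast; ring
  rw [this]
  push_cast
  ring

lemma fourierTail_neg_neg {a : ℝ} (ha : a ≠ 0) (b d : ℝ) (k : ℕ) (s : ℂ) :
    fourierTail (-a) (-b) d k s = -fourierTail a b d k s := by
  have h1 : axisUnit (-a) = -axisUnit a := by
    unfold axisUnit
    rcases ha.lt_or_gt with h | h
    · simp [h, h.not_gt]
    · simp [h, h.le]
  rw [fourierTail, fourierTail, h1, abs_neg, neg_neg]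
  have e : Complex.I * (2 * π * ((-b : ℝ) : ℂ) * k) = -(Complex.I * (2 * π * b * k)) := by
    push_cast; ring
  rw [e, neg_neg]
  ring

lemma zetaSide_eq_tsum {a : ℝ} (ha : a ≠ 0) (b : ℝ) {d : ℝ} (hd : 0 < d) {s : ℂ} (hs : 1 < s.re) :
    zetaSide a b d s = ∑' k : ℕ, fourierTail a b d (k + 1) s := by
  rcases ha.lt_or_gt with h | h
  · rw [zetaSide_neg_neg h, zetaSide_eq_tsum_of_pos (neg_pos.2 h) (-b) hd hs, ← tsum_neg]
    exact tsum_congr fun k => by rw [fourierTail_neg_neg ha, neg_neg]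
  · exact zetaSide_eq_tsum_of_pos h b hd hs

/-! ### The limit of the hypergeometric partial sums. -/

lemma intervalIntegrable_mul_cpow_of_linear_bound {f : ℝ → ℂ} (hf : Continuous f) {C : ℝ}
    (h : ∀ x ∈ Ioc (0 : ℝ) 1, ‖f x‖ ≤ C * x) {s : ℂ} (hs : s.re < 1) :
    IntervalIntegrable (fun x : ℝ => f x * (x : ℂ) ^ (-s - 1)) volume 0 1 := by
  have hb : IntervalIntegrable (fun x : ℝ => C * x ^ (-s.re)) volume 0 1 :=
    (intervalIntegral.intervalIntegrable_rpow' (by linarith)).const_mul C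
  have hcont : ContinuousOn (fun x : ℝ => f x * (x : ℂ) ^ (-s - 1)) (Ioc 0 1) :=
    hf.continuousOn.mul fun x hx =>
      (Complex.continuousAt_ofReal_cpow_const x _ (Or.inr hx.1.ne')).continuousWithinAt
  refine hb.mono_fun' ?_ ?_
  · rw [uIoc_of_le zero_le_one]
    exact hcont.aestronglyMeasurable measurableSet_Ioc
  · rw [uIoc_of_le zero_le_one]
    refine (ae_restrict_iff' measurableSet_Ioc).2 (Eventually.of_forall fun x hx => ?_)
    simp only
    rw [norm_mul, norm_ofReal_cpow_of_pos hx.1]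
    have e : x ^ (-s.re) = x * x ^ (-s - 1).re := by
      have : (-s - 1).re = -s.re - 1 := by simp
      rw [this, rpow_sub_one hx.1.ne', mul_div_cancel₀ _ hx.1.ne']
    rw [e, ← mul_assoc]
    have := hx.1.le
    gcongr
    exact h x hx

lemma intervalIntegrable_exp_sub_one_mul_cpow (z : ℂ) {s : ℂ} (hs : s.re < 1) :
    IntervalIntegrable (fun x : ℝ => (Complex.exp (z * x) - 1) * (x : ℂ) ^ (-s - 1)) volume 0 1 := by
  refine intervalIntegrable_mul_cpow_of_linear_bound (C := ‖z‖ * exp ‖z‖) (by fun_prop) (fun x hx => ?_) hs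
  have h := Complex.norm_exp_sub_sum_le_norm_mul_exp (z * x) 1
  simp only [Finset.range_one, Finset.sum_singleton, pow_zero, Nat.factorial_zero, Nat.cast_one,
    div_one, pow_one, norm_mul, Complex.norm_real, Real.norm_eq_abs, abs_of_pos hx.1] at h
  refine h.trans ?_
  rw [mul_right_comm]
  have := hx.1.le
  gcongr
  exact mul_le_of_le_one_right (norm_nonneg z) hx.2

/-- Subtracting the value at `x = 0` makes the integral converge for `Re s < 1`. The final term
continues the integral of that constant, since `∫_0^1 x^{-s-1} dx = -1/s` for `Re s < 0`. -/
lemma neg_hyperTerm_eq_integral (a b : ℝ) {k : ℕ} (hk : 1 ≤ k) {s : ℂ} (hs : s.re < 1) (hs0 : s ≠ 0) :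
    IntervalIntegrable (fun x : ℝ => ((sin (2 * π * k * (a * x + b)) / k - sin (2 * π * k * b) / k : ℝ) : ℂ)
        * (x : ℂ) ^ (-s - 1)) volume 0 1 ∧
    -hyperTerm a b 1 k s
      = (∫ x in (0 : ℝ)..1, ((sin (2 * π * k * (a * x + b)) / k - sin (2 * π * k * b) / k : ℝ) : ℂ)
        * (x : ℂ) ^ (-s - 1)) - ((sin (2 * π * k * b) / k : ℝ) : ℂ) / s := by
  have hn : ∀ n : ℕ, s ≠ n := by
    rintro (_ | n) h
    · simp at h; exact hs0 h
    · have hn : (0 : ℝ) ≤ n := n.cast_nonneg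
      rw [h] at hs; simp at hs; linarith
  have hk0 : (k : ℂ) ≠ 0 := Nat.cast_ne_zero.2 (by lia)
  set z : ℂ := 2 * π * k * a * Complex.I with hz
  set θ : ℂ := 2 * π * b * k with hθ
  have i1 := (intervalIntegrable_exp_sub_one_mul_cpow z hs).const_mul (Complex.exp (Complex.I * θ))
  have i2 := (intervalIntegrable_exp_sub_one_mul_cpow (-z) hs).const_mul (Complex.exp (-(Complex.I * θ)))
  have k1 := integral_exp_sub_one_mul_cpow z one_pos hs hs0
  have k2 := integral_exp_sub_one_mul_cpow (-z) one_pos hs hs0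
  simp only [Complex.ofReal_one, Complex.one_cpow, one_mul, mul_one] at k1 k2
  have hfun : (fun x : ℝ => ((sin (2 * π * k * (a * x + b)) / k - sin (2 * π * k * b) / k : ℝ) : ℂ)
        * (x : ℂ) ^ (-s - 1))
      = fun x : ℝ => 1 / (2 * Complex.I * k) *
        (Complex.exp (Complex.I * θ) * ((Complex.exp (z * x) - 1) * (x : ℂ) ^ (-s - 1))
        - Complex.exp (-(Complex.I * θ)) * ((Complex.exp (-z * x) - 1) * (x : ℂ) ^ (-s - 1))) := by
    funext x
    have e1 : Complex.exp (Complex.I * θ) * Complex.exp (z * x)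
        = Complex.exp ((2 * π * k * (a * x + b)) * Complex.I) := by
      rw [← Complex.exp_add]; congr 1; rw [hz, hθ]; ring
    have e2 : Complex.exp (-(Complex.I * θ)) * Complex.exp (-z * x)
        = Complex.exp (-(2 * π * k * (a * x + b)) * Complex.I) := by
      rw [← Complex.exp_add]; congr 1; rw [hz, hθ]; ring
    have e3 : Complex.exp (Complex.I * θ) = Complex.exp ((2 * π * k * b) * Complex.I) := by
      congr 1; rw [hθ]; ring
    have e4 : Complex.exp (-(Complex.I * θ)) = Complex.exp (-(2 * π * k * b) * Complex.I) := by
      congr 1; rw [hθ]; ring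
    rw [← mul_assoc (Complex.exp (Complex.I * θ)), ← mul_assoc (Complex.exp (-(Complex.I * θ))),
      mul_sub (Complex.exp (Complex.I * θ)), mul_sub (Complex.exp (-(Complex.I * θ))), e1, e2, mul_one, mul_one, e3, e4]
    push_cast
    rw [Complex.sin, Complex.sin]
    field_simp
    rw [Complex.I_sq]
    ring
  rw [hfun]
  refine ⟨(i1.sub i2).const_mul _, ?_⟩
  rw [intervalIntegral.integral_const_mul, intervalIntegral.integral_sub i1 i2,
    intervalIntegral.integral_const_mul, intervalIntegral.integral_const_mul, k1, k2,
    hyperTerm_eq a b one_pos hk hn]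
  simp only [Complex.ofReal_one, Complex.one_cpow, one_mul, mul_one]
  have e5 : ((sin (2 * π * k * b) / k : ℝ) : ℂ)
      = (Complex.exp (-(Complex.I * θ)) - Complex.exp (Complex.I * θ)) * Complex.I / 2 / k := by
    push_cast
    rw [Complex.sin]
    congr 5
    · rw [hθ]; ring
    · rw [hθ]; ring
  rw [e5, ← hz, ← hθ]
  field_simp
  rw [Complex.I_sq]
  ring

lemma sum_neg_hyperTerm (a b : ℝ) {s : ℂ} (hs : s.re < 1) (hs0 : s ≠ 0) (N : ℕ) :
    ∑ k ∈ Finset.range N, -hyperTerm a b 1 (k + 1) s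
      = (∫ x in (0 : ℝ)..1, ((sawSum N (a * x + b) - sawSum N b : ℝ) : ℂ) * (x : ℂ) ^ (-s - 1))
        - (sawSum N b : ℂ) / s := by
  have h := fun k : ℕ => neg_hyperTerm_eq_integral a b (Nat.le_add_left 1 k) hs hs0
  rw [Finset.sum_congr rfl fun k _ => (h k).2, Finset.sum_sub_distrib,
    ← intervalIntegral.integral_finsetSum fun k _ => (h k).1]
  congr 1
  · refine intervalIntegral.integral_congr fun x _ => ?_
    simp only [sawSum]
    rw [← Finset.sum_mul, ← Finset.sum_sub_distrib, Complex.ofReal_sum]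
    push_cast
    rfl
  · simp only [sawSum]
    rw [Complex.ofReal_sum, Finset.sum_div]
    push_cast
    rfl

/-- Dominated convergence for the sawtooth series integrated against a power. -/
lemma tendsto_sum_neg_hyperTerm (a b : ℝ) {s : ℂ} (hs : s.re < 1) (hs0 : s ≠ 0) {g : ℝ → ℝ}
    (hg : IntervalIntegrable g volume 0 1)
    (hle : ∀ (N : ℕ), ∀ x ∈ Ioc (0 : ℝ) 1,
      ‖((sawSum N (a * x + b) - sawSum N b : ℝ) : ℂ) * (x : ℂ) ^ (-s - 1)‖ ≤ g x) :
    IntervalIntegrable (fun x : ℝ => ((saw (a * x + b) - saw b : ℝ) : ℂ) * (x : ℂ) ^ (-s - 1)) volume 0 1 ∧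
    Tendsto (fun N => ∑ k ∈ Finset.range N, -hyperTerm a b 1 (k + 1) s) atTop
      (𝓝 ((∫ x in (0 : ℝ)..1, ((saw (a * x + b) - saw b : ℝ) : ℂ) * (x : ℂ) ^ (-s - 1))
        - (saw b : ℂ) / s)) := by
  have hlim : ∀ x : ℝ, Tendsto (fun N => ((sawSum N (a * x + b) - sawSum N b : ℝ) : ℂ) * (x : ℂ) ^ (-s - 1))
      atTop (𝓝 (((saw (a * x + b) - saw b : ℝ) : ℂ) * (x : ℂ) ^ (-s - 1))) := fun x =>
    Tendsto.mul_const _ ((Complex.continuous_ofReal.tendsto _).comp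
      ((tendsto_sawSum _).sub (tendsto_sawSum _)))
  have hpow : AEStronglyMeasurable (fun x : ℝ => (x : ℂ) ^ (-s - 1)) (volume.restrict (Ioc 0 1)) :=
    ContinuousOn.aestronglyMeasurable (fun x hx =>
      (Complex.continuousAt_ofReal_cpow_const x _ (Or.inr hx.1.ne')).continuousWithinAt) measurableSet_Ioc
  have hu : uIoc (0 : ℝ) 1 = Ioc 0 1 := uIoc_of_le zero_le_one
  constructor
  · refine hg.mono_fun' ?_ ?_
    · rw [hu]
      have : Measurable fun x : ℝ => ((saw (a * x + b) - saw b : ℝ) : ℂ) :=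
        Complex.measurable_ofReal.comp ((measurable_saw.comp (by fun_prop)).sub measurable_const)
      exact this.aestronglyMeasurable.mul hpow
    · rw [hu]
      exact (ae_restrict_iff' measurableSet_Ioc).2 (Eventually.of_forall fun x hx =>
        le_of_tendsto (hlim x).norm (Eventually.of_forall fun N => hle N x hx))
  · simp_rw [sum_neg_hyperTerm a b hs hs0]
    refine Tendsto.sub ?_ (((Complex.continuous_ofReal.tendsto _).comp (tendsto_sawSum b)).div_const s)
    refine intervalIntegral.tendsto_integral_filter_of_dominated_convergence g ?_ ?_ hg ?_
    · refine Eventually.of_forall fun N => ?_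
      rw [hu]
      have : Continuous fun x : ℝ => ((sawSum N (a * x + b) - sawSum N b : ℝ) : ℂ) :=
        Complex.continuous_ofReal.comp (((continuous_sawSum N).comp (by fun_prop)).sub continuous_const)
      exact this.aestronglyMeasurable.mul hpow
    · refine Eventually.of_forall fun N => Eventually.of_forall fun x hx => ?_
      rw [hu] at hx
      exact hle N x hx
    · exact Eventually.of_forall fun x _ => hlim x

/-- The floor remainder as an integral over `(0, 1)`. -/
lemma floorRemainder_one {a : ℝ} (ha : a ≠ 0) (b : ℝ) {s : ℂ}
    (hi : IntervalIntegrable (fun x : ℝ => (⌊a * x + Int.fract b⌋ : ℂ) * (x : ℂ) ^ (-s - 1)) volume 0 1) :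
    floorRemainder a b 1 s
      = -(s * ∫ x in (0 : ℝ)..1, (⌊a * x + Int.fract b⌋ : ℂ) * (x : ℂ) ^ (-s - 1)) := by
  have hβ0 := Int.fract_nonneg b
  have hβ1 := Int.fract_lt_one b
  rw [floorRemainder]
  set β := Int.fract b with hβ
  set x0 := (1 - β) / a with hx0
  have hax0 : a * x0 = 1 - β := by rw [hx0]; field_simp
  -- The point `x0` must be excluded: for `a > 0` it belongs to the interval, and the floor already
  -- equals `1` there.
  have hzero : ∀ᵐ x : ℝ, x ∈ uIoc 0 x0 → (0 : ℂ) = (⌊a * x + β⌋ : ℂ) * (x : ℂ) ^ (-s - 1) := by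
    filter_upwards [(countable_singleton x0).ae_notMem volume] with x hx hxm
    have hne : x ≠ x0 := hx
    have : ⌊a * x + β⌋ = 0 := by
      refine Int.floor_eq_zero_iff.2 ?_
      rcases ha.lt_or_gt with h | h
      · have h0 : x0 < 0 := div_neg_of_pos_of_neg (by linarith) h
        rw [uIoc_of_ge h0.le] at hxm
        exact ⟨by nlinarith [hxm.2], by nlinarith [mul_lt_mul_of_neg_left hxm.1 h]⟩
      · have h0 : 0 < x0 := div_pos (by linarith) h
        rw [uIoc_of_le h0.le] at hxm
        have hlt := lt_of_le_of_ne hxm.2 hne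
        exact ⟨by nlinarith [hxm.1], by nlinarith [mul_lt_mul_of_pos_left hlt h]⟩
    rw [this]; simp
  have i0 : IntervalIntegrable (fun x : ℝ => (⌊a * x + β⌋ : ℂ) * (x : ℂ) ^ (-s - 1)) volume 0 x0 :=
    (intervalIntegrable_const (c := (0 : ℂ))).congr_ae
      ((ae_restrict_iff' measurableSet_uIoc).2 hzero)
  have v0 : ∫ x in (0 : ℝ)..x0, (⌊a * x + β⌋ : ℂ) * (x : ℂ) ^ (-s - 1) = 0 := by
    rw [← intervalIntegral.integral_congr_ae hzero]; simp
  have := intervalIntegral.integral_add_adjacent_intervals hi (hi.symm.trans i0)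
  rw [intervalIntegral.integral_same, sub_zero]
  linear_combination s * (this.trans v0)

lemma tendsto_sum_neg_hyperTerm_of_bound {a : ℝ} (ha : a ≠ 0) (b : ℝ) {s : ℂ} (hs : s.re < 1) (hs0 : s ≠ 0)
    {g : ℝ → ℝ} (hg : IntervalIntegrable g volume 0 1)
    (hle : ∀ (N : ℕ), ∀ x ∈ Ioc (0 : ℝ) 1,
      ‖((sawSum N (a * x + b) - sawSum N b : ℝ) : ℂ) * (x : ℂ) ^ (-s - 1)‖ ≤ g x)
    (hb : saw b = π * (1 / 2 - Int.fract b) ∨ s.re < 0) :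
    Tendsto (fun N => ∑ k ∈ Finset.range N, -hyperTerm a b 1 (k + 1) s) atTop
      (𝓝 (π / s * (a * s / (s - 1) + ((Int.fract b : ℝ) : ℂ) - 1 / 2 - floorRemainder a b 1 s))) := by
  obtain ⟨hsaw, hlim⟩ := tendsto_sum_neg_hyperTerm a b hs hs0 hg hle
  have hπ : (π : ℂ) ≠ 0 := Complex.ofReal_ne_zero.2 pi_ne_zero
  have hs1 : s - 1 ≠ 0 := fun h => by rw [sub_eq_zero.1 h] at hs; simp at hs
  -- `κ` measures the convention at the jump: it is `0` for `b ∉ ℤ` and `π/2` for `b ∈ ℤ`. In the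
  -- latter case `κ x^{-s-1}` must itself be integrable at `0`, hence `Re s < 0`.
  set κ : ℂ := π * (1 / 2 - Int.fract b) - saw b with hκ
  have hpow : IntervalIntegrable (fun x : ℝ => κ * (x : ℂ) ^ (-s - 1)) volume 0 1 ∧
      ∫ x in (0 : ℝ)..1, κ * (x : ℂ) ^ (-s - 1) = -(κ / s) := by
    rcases hb with hb | hb
    · have : κ = 0 := by rw [hκ, hb]; push_cast; ring
      simp [this]
    · have hre : -1 < (-s - 1).re := by simp; linarith
      refine ⟨(intervalIntegral.intervalIntegrable_cpow' hre).const_mul κ, ?_⟩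
      rw [intervalIntegral.integral_const_mul, integral_cpow (Or.inl hre), sub_add_cancel,
        Complex.ofReal_zero, Complex.zero_cpow (neg_ne_zero.2 hs0), Complex.ofReal_one, Complex.one_cpow,
        sub_zero, one_div, inv_neg]
      ring
  have hre : -1 < (-s).re := by simp; linarith
  have hlin : IntervalIntegrable (fun x : ℝ => (π * a : ℂ) * (x : ℂ) ^ (-s)) volume 0 1 :=
    (intervalIntegral.intervalIntegrable_cpow' hre).const_mul _
  have hlin_val : ∫ x in (0 : ℝ)..1, (π * a : ℂ) * (x : ℂ) ^ (-s) = -(π * a / (s - 1)) := by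
    have hne : -s + 1 ≠ 0 := fun h => hs1 (by linear_combination -h)
    rw [intervalIntegral.integral_const_mul, integral_cpow (Or.inl hre), Complex.ofReal_zero,
      Complex.zero_cpow hne, Complex.ofReal_one, Complex.one_cpow, sub_zero,
      show -s + 1 = -(s - 1) by ring]
    field_simp
  have hae : ∀ᵐ x : ℝ, x ∈ uIoc (0 : ℝ) 1 →
      (1 / π : ℂ) * (((saw (a * x + b) - saw b : ℝ) : ℂ) * (x : ℂ) ^ (-s - 1)
        - κ * (x : ℂ) ^ (-s - 1) + (π * a : ℂ) * (x : ℂ) ^ (-s))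
      = (⌊a * x + Int.fract b⌋ : ℂ) * (x : ℂ) ^ (-s - 1) := by
    filter_upwards [ae_saw_eq ha b] with x hx hxm
    rw [uIoc_of_le zero_le_one] at hxm
    have hx0 : (x : ℂ) ≠ 0 := Complex.ofReal_ne_zero.2 hxm.1.ne'
    have : (x : ℂ) ^ (-s) = x * (x : ℂ) ^ (-s - 1) := by
      rw [mul_comm, ← cpow_add_one_of_ne_zero _ hx0, sub_add_cancel]
    rw [hx, this, hκ]
    push_cast
    field_simp
    ring
  -- Solving the sawtooth formula for the floor transfers integrability from the other terms,
  -- without a separate estimate near `0`.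
  have hfloor : IntervalIntegrable (fun x : ℝ => (⌊a * x + Int.fract b⌋ : ℂ) * (x : ℂ) ^ (-s - 1)) volume 0 1 :=
    (((hsaw.sub hpow.1).add hlin).const_mul (1 / π : ℂ)).congr_ae
      ((ae_restrict_iff' measurableSet_uIoc).2 hae)
  have hval := intervalIntegral.integral_congr_ae hae
  rw [intervalIntegral.integral_const_mul, intervalIntegral.integral_add (hsaw.sub hpow.1) hlin,
    intervalIntegral.integral_sub hsaw hpow.1, hpow.2, hlin_val] at hval
  rw [floorRemainder_one ha b hfloor, ← hval]
  convert hlim using 2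
  rw [hκ]
  field_simp
  ring

lemma tendsto_sum_hypergeometric {a : ℝ} (ha : a ≠ 0) (b : ℝ) {s : ℂ} (hs0 : s ≠ 0)
    (h : (s.re < 1 ∧ ∀ m : ℤ, b ≠ m) ∨ (s.re < 0 ∧ ∃ m : ℤ, b = m)) :
    Tendsto (fun N => ∑ k ∈ Finset.range N, -hyperTerm a b 1 (k + 1) s) atTop
      (𝓝 (π / s * (a * s / (s - 1) + ((Int.fract b : ℝ) : ℂ) - 1 / 2 - floorRemainder a b 1 s))) := by
  have hre : (-s - 1).re = -s.re - 1 := by simp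
  rcases h with ⟨hs, hb⟩ | ⟨hs, hb⟩
  -- The Lipschitz bound at `b` supplies a factor `x`, and `x^{-Re s}` is integrable on `(0, 1)` for
  -- `Re s < 1`.
  · obtain ⟨C, hC⟩ := exists_abs_sawSum_sub_le hb
    refine tendsto_sum_neg_hyperTerm_of_bound ha b hs hs0 (g := fun x => C * |a| * x ^ (-s.re))
      ((intervalIntegral.intervalIntegrable_rpow' (by linarith)).const_mul _) (fun N x hx => ?_) (Or.inl ?_)
    · rw [norm_mul, norm_ofReal_cpow_of_pos hx.1, Complex.norm_real, Real.norm_eq_abs, hre]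
      have e : x ^ (-s.re) = x * x ^ (-s.re - 1) := by
        rw [rpow_sub_one hx.1.ne']; have := hx.1.ne'; field_simp
      have h1 := hC N (a * x)
      rw [add_comm b, abs_mul, abs_of_pos hx.1, ← mul_assoc] at h1
      rw [e, ← mul_assoc]
      exact mul_le_mul_of_nonneg_right h1 (rpow_nonneg hx.1.le _)
    · rw [saw, if_neg]
      intro hf
      obtain ⟨m, hm⟩ := Int.fract_eq_zero_iff.1 hf
      exact hb m hm.symm
  -- At the jump no Lipschitz bound uniform in `N` exists; the crude bound `8 + 8` suffices because
  -- `Re s < 0`.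
  · refine tendsto_sum_neg_hyperTerm_of_bound ha b (by linarith) hs0 (g := fun x => 16 * x ^ (-s.re - 1))
      ((intervalIntegral.intervalIntegrable_rpow' (by linarith)).const_mul _) (fun N x hx => ?_) (Or.inr hs)
    rw [norm_mul, norm_ofReal_cpow_of_pos hx.1, Complex.norm_real, Real.norm_eq_abs, hre]
    refine mul_le_mul_of_nonneg_right ?_ (rpow_nonneg hx.1.le _)
    refine (abs_sub _ _).trans ?_
    linarith [abs_sawSum_le N (a * x + b), abs_sawSum_le N b]

end

theorem theorem1p1 :
    -- `F a b d k` is the `k`-th term, continued to an entire function of `s`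
    (∃ F : ℝ → ℝ → ℝ → ℕ → ℂ → ℂ,
      (∀ a b d : ℝ, a ≠ 0 → 0 < d →
        (∀ k : ℕ, 1 ≤ k → Differentiable ℂ (F a b d k) ∧
          ∀ s : ℂ, (∀ n : ℕ, s ≠ n) →
            F a b d k s = hyperTerm a b d k s + gammaTerm a b k s) ∧
        (∀ s : ℂ, Summable fun k : ℕ => ‖F a b d (k + 1) s‖) ∧
        Differentiable ℂ (fun s : ℂ => ∑' k : ℕ, F a b d (k + 1) s) ∧
        (∀ s : ℂ, 1 < s.re → zetaSide a b d s = ∑' k : ℕ, F a b d (k + 1) s)) ∧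
      (∀ c C ε : ℝ, 0 < c → 0 < ε →
        AbsUnifConvOn
          (fun k (p : ℝ × ℝ × ℝ × ℂ) =>
            (p.2.2.1 : ℂ) ^ p.2.2.2 * F p.1 p.2.1 p.2.2.1 (k + 1) p.2.2.2)
          (paramRegion c C ε) ∧
        ∀ B : ℝ, AbsUnifConvOn
          (fun k (p : ℝ × ℝ × ℝ × ℂ) => F p.1 p.2.1 p.2.2.1 (k + 1) p.2.2.2)
          (paramRegion c C ε ∩ {p | 1 ≤ p.2.2.1 ∨ p.2.2.2.re ≤ B}))) ∧
    (∀ (a b : ℝ) (s : ℂ), a ≠ 0 → s ≠ 0 →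
      ((s.re < 1 ∧ ∀ m : ℤ, b ≠ m) ∨ (s.re < 0 ∧ ∃ m : ℤ, b = m)) →
      Filter.Tendsto
        (fun N : ℕ => ∑ k ∈ Finset.Icc 1 N,
          (2 * Real.pi * a * (Real.cos (2 * Real.pi * b * k) : ℂ) / (1 - s) *
              hyp1F2 ((1 - s) / 2) (3 / 2) (1 + (1 - s) / 2)
                (-((Real.pi ^ 2 * a ^ 2 * (k : ℝ) ^ 2 : ℝ) : ℂ))
            - (Real.sin (2 * Real.pi * b * k) : ℂ) / (s * k) *
              hyp1F2 (-s / 2) (1 / 2) (1 - s / 2)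
                (-((Real.pi ^ 2 * a ^ 2 * (k : ℝ) ^ 2 : ℝ) : ℂ))))
        Filter.atTop
        (nhds (Real.pi / s * (a * s / (s - 1) + ((Int.fract b : ℝ) : ℂ) - 1 / 2
          - floorRemainder a b 1 s)))) := by
  refine ⟨⟨fourierTail, fun a b d ha hd => ⟨fun k hk => ⟨differentiable_fourierTail ha b hd hk,
      fun s hs => fourierTail_eq ha b hd hk hs⟩, summable_norm_fourierTail ha b hd,
      differentiable_tsum_fourierTail ha b hd, fun s hs => zetaSide_eq_tsum ha b hd hs⟩,
    fun c C ε hc hε => ⟨absUnifConvOn_scaled_fourierTail hc,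
      fun B => absUnifConvOn_fourierTail hc hε B⟩⟩, fun a b s ha hs0 h => ?_⟩
  convert tendsto_sum_hypergeometric ha b hs0 h using 2 with N
  -- The index shift from `k + 1` with `k < N` to `1 ≤ k ≤ N`.
  rw [Finset.range_eq_Ico, Finset.sum_Ico_add' (fun k => -hyperTerm a b 1 k s) 0 N 1]
  refine Finset.sum_congr (by ext; simp) fun k _ => ?_
  simp only [hyperTerm, Complex.ofReal_one, Complex.one_cpow, one_mul, mul_one, one_pow]
  ring
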